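/- Let $(M^2,g)$ and $(N^n,h)$ be smooth Riemannian manifolds (without boundary), $\dim M=2$, $n\ge 0$ arbitrary, let $\varphi:M\to N$ be a smooth map, let $F:M\to(0,\infty)$ be a smooth function, and let $\bar g=F^{-2}g$. For a Riemannian metric $g$ on $M$ let $\tau(\varphi,g)=\mathrm{Trace}_g\nabla d\varphi$ be the tension field of $\varphi$, and let $$\tau^2(\varphi,g)=\mathrm{Trace}_g\big(\nabla^\varphi\nabla^\varphi-\nabla^\varphi_{\nabla^M}\big)\tau(\varphi,g)-\mathrm{Trace}_g R^N\big(d\varphi,\tau(\varphi,g)\big)d\varphi$$ be its bitension field, where $\nabla^M$ is the Levi-Civita connection of $g$, $\nabla^N$ that of $h$, $\nabla^\varphi$ is the pull-back of $\nabla^N$ to $\varphi^{-1}TN$, and $R^N(X,Y)Z=\nabla^N_X\nabla^N_YZ-\nabla^N_Y\nabla^N_XZ-\nabla^N_{[X,Y]}Z$. Then, at every point of $M$, $$\tau^2(\varphi,\bar g)=F^4\Big\{\tau^2(\varphi,g)+2\big(\Delta\ln F+2|\mathrm{grad}\ln F|^2\big)\tau(\varphi,g)+4\,\nabla^\varphi_{\mathrm{grad}\ln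 F}\,\tau(\varphi,g)\Big\},$$ where $\mathrm{grad}$, $|\cdot|$ and $\Delta=\mathrm{Trace}_g\nabla d$ are taken with respect to $g$. -/

import Mathlib

open Bundle VectorField
open scoped Manifold ContDiff

noncomputable section

namespace Biharmonic

section OneManifold

variable {E : Type*} [NormedAddCommGroup E] [NormedSpace ℝ E] [FiniteDimensional ℝ E]
  {H : Type*} [TopologicalSpace H] (I : ModelWithCorners ℝ E H)
  {M : Type*} [TopologicalSpace M] [ChartedSpace H M] [IsManifold I ∞ M]

/-- Smooth Riemannian metrics on `M`. -/
abbrev Metric (M : Type*) [TopologicalSpace M] [ChartedSpace H M] [IsManifold I ∞ M] : Type _ :=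
  ContMDiffRiemannianMetric I ∞ E (TangentSpace I : M → Type _)

/-- The coordinate frame `∂₁, …, ∂ₘ` on the domain of the preferred chart at `p`
(extended by zero outside that domain). -/
def frame (p : M) (i : Fin (Module.finrank ℝ E)) (x : M) : TangentSpace I x :=
  (trivializationAt E (TangentSpace I : M → Type _) p).localFrame (Module.finBasis ℝ E) i x

/-- The `i`-th component of a tangent vector at `x` in the coordinate frame `frame I p`. -/
def frameCoeff (p : M) (i : Fin (Module.finrank ℝ E)) (x : M) (v : TangentSpace I x) : ℝ :=
  (trivializationAt E (TangentSpace I : M → Type _) p).localFrameCoeff I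
    (Module.finBasis ℝ E) i x v

/-- A vector field, smooth near `x`, with value `v` at `x`: the one with constant components in the
preferred chart at `x`. -/
def extendVec {x : M} (v : TangentSpace I x) (y : M) : TangentSpace I y :=
  FiberBundle.extend E (E := (TangentSpace I : M → Type _)) v y

variable {I}

/-- The inverse `g^{ij}` of the matrix `g_{ij} = g(∂ᵢ, ∂ⱼ)` at the point `x`, in the coordinate frame
of the preferred chart at `x`. -/
def invGram (g : Metric I M) (x : M) :
    Matrix (Fin (Module.finrank ℝ E)) (Fin (Module.finrank ℝ E)) ℝ :=
  (Matrix.of fun i j => g.inner x (frame I x i x) (frame I x j x))⁻¹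

/-- `Trace_g B = ∑ g^{ij} B(∂ᵢ, ∂ⱼ)` at `x`, for a bilinear form `B` on `T_x M`, given through its
components `B i j = B(∂ᵢ, ∂ⱼ)` in the coordinate frame at `x`. -/
def trace (g : Metric I M) (x : M) {W : Type*} [AddCommGroup W] [Module ℝ W]
    (B : Fin (Module.finrank ℝ E) → Fin (Module.finrank ℝ E) → W) : W :=
  ∑ i, ∑ j, invGram g x i j • B i j

/-- The tangent vector `w` at `x` with `g(w, ·) = α`. -/
def sharp (g : Metric I M) (x : M) (α : TangentSpace I x → ℝ) : TangentSpace I x :=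
  ∑ i, ∑ j, (invGram g x i j * α (frame I x i x)) • frame I x j x

/-- The right-hand side of the Koszul formula for `2 g(∇_X Y, Z)`. -/
def koszul (g : Metric I M) (X Y Z : Π x : M, TangentSpace I x) (x : M) : ℝ :=
  mvfderiv I (fun y => g.inner y (Y y) (Z y)) x (X x)
    + mvfderiv I (fun y => g.inner y (X y) (Z y)) x (Y x)
    - mvfderiv I (fun y => g.inner y (X y) (Y y)) x (Z x)
    + g.inner x (mlieBracket I X Y x) (Z x)
    - g.inner x (mlieBracket I X Z x) (Y x)
    - g.inner x (mlieBracket I Y Z x) (X x)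

/-- The Levi-Civita connection of `g`: `leviCivita g Y x v` is `(∇_v Y)(x)`, the vector `w` with
`2 g(w, z) = koszul g V Y Z x` whenever `V`, `Z` are vector fields with values `v`, `z` at `x`. -/
def leviCivita (g : Metric I M) (Y : Π x : M, TangentSpace I x) (x : M) (v : TangentSpace I x) :
    TangentSpace I x :=
  sharp g x fun z => koszul g (extendVec I v) Y (extendVec I z) x / 2

/-- The curvature operator
`R(u, v) w = ∇_U ∇_V W - ∇_V ∇_U W - ∇_{[U, V]} W`, where `U`, `V`, `W` extend `u`, `v`, `w`. -/
def curvature (g : Metric I M) (x : M) (u v w : TangentSpace I x) : TangentSpace I x :=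
  leviCivita g (fun y => leviCivita g (extendVec I w) y (extendVec I v y)) x u
    - leviCivita g (fun y => leviCivita g (extendVec I w) y (extendVec I u y)) x v
    - leviCivita g (extendVec I w) x (mlieBracket I (extendVec I u) (extendVec I v) x)

/-- The gradient of a function. -/
def grad (g : Metric I M) (f : M → ℝ) (x : M) : TangentSpace I x :=
  sharp g x fun v => mvfderiv I f x v

/-- The Laplacian `Δ f = Trace_g ∇ d f`, where `∇ d f (X, Y) = X (Y f) - (∇_X Y) f`. -/
def laplacian (g : Metric I M) (f : M → ℝ) (x : M) : ℝ :=
  trace g x fun i j =>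
    mvfderiv I (fun y => mvfderiv I f y (frame I x j y)) x (frame I x i x)
      - mvfderiv I f x (leviCivita g (frame I x j) x (frame I x i x))

end OneManifold

section Maps

variable {E : Type*} [NormedAddCommGroup E] [NormedSpace ℝ E] [FiniteDimensional ℝ E]
  {H : Type*} [TopologicalSpace H] {I : ModelWithCorners ℝ E H}
  {M : Type*} [TopologicalSpace M] [ChartedSpace H M] [IsManifold I ∞ M]
  {E' : Type*} [NormedAddCommGroup E'] [NormedSpace ℝ E'] [FiniteDimensional ℝ E']
  {H' : Type*} [TopologicalSpace H'] {J : ModelWithCorners ℝ E' H'}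
  {N : Type*} [TopologicalSpace N] [ChartedSpace H' N] [IsManifold J ∞ N]

variable (I) in
/-- The pull-back connection `∇^φ` on `φ⁻¹ TN`: if `V = ∑ Vᵃ (∂ₐ ∘ φ)` near `x`, then
`∇^φ_v V = ∑ (d Vᵃ(v) ∂ₐ + Vᵃ ∇^N_{dφ(v)} ∂ₐ)` at `x`. -/
def pullbackConn (h : Metric J N) (φ : M → N) (V : Π x : M, TangentSpace J (φ x)) (x : M)
    (v : TangentSpace I x) : TangentSpace J (φ x) :=
  ∑ a, (mvfderiv I (fun y => frameCoeff J (φ x) a (φ y) (V y)) x v • frame J (φ x) a (φ x)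
    + frameCoeff J (φ x) a (φ x) (V x) •
        leviCivita h (frame J (φ x) a) (φ x) (mfderiv I J φ x v))

/-- The tension field `τ(φ, g) = Trace_g ∇ dφ`, where
`∇ dφ (X, Y) = ∇^φ_X (dφ Y) - dφ(∇_X Y)`. -/
def tension (g : Metric I M) (h : Metric J N) (φ : M → N) (x : M) : TangentSpace J (φ x) :=
  trace g x fun i j =>
    pullbackConn I h φ (fun y => mfderiv I J φ y (frame I x j y)) x (frame I x i x)
      - mfderiv I J φ x (leviCivita g (frame I x j) x (frame I x i x))

/-- `Trace_g (∇^φ ∇^φ - ∇^φ_{∇^M}) V` for a vector field `V` along `φ`. -/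
def roughLaplacian (g : Metric I M) (h : Metric J N) (φ : M → N)
    (V : Π x : M, TangentSpace J (φ x)) (x : M) : TangentSpace J (φ x) :=
  trace g x fun i j =>
    pullbackConn I h φ (fun y => pullbackConn I h φ V y (frame I x j y)) x (frame I x i x)
      - pullbackConn I h φ V x (leviCivita g (frame I x j) x (frame I x i x))

/-- The Jacobi operator
`J(V) = -(Trace_g (∇^φ ∇^φ - ∇^φ_{∇^M}) V - Trace_g R^N(dφ, V) dφ)`. -/
def jacobi (g : Metric I M) (h : Metric J N) (φ : M → N)
    (V : Π x : M, TangentSpace J (φ x)) (x : M) : TangentSpace J (φ x) :=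
  -(roughLaplacian g h φ V x
    - trace g x fun i j => curvature h (φ x)
        (mfderiv I J φ x (frame I x i x)) (V x) (mfderiv I J φ x (frame I x j x)))

/-- The bitension field `τ²(φ, g) = -J(τ(φ, g))`, that is
`Trace_g (∇^φ ∇^φ - ∇^φ_{∇^M}) τ - Trace_g R^N(dφ, τ) dφ` with `τ = τ(φ, g)`. -/
def bitension (g : Metric I M) (h : Metric J N) (φ : M → N) (x : M) : TangentSpace J (φ x) :=
  -jacobi g h φ (tension g h φ) x

end Maps

end Biharmonic

end

set_option linter.unusedSectionVars false

noncomputable section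
namespace Biharmonic

section OneManifold

variable {E : Type*} [NormedAddCommGroup E] [NormedSpace ℝ E] [FiniteDimensional ℝ E]
  {H : Type*} [TopologicalSpace H] {I : ModelWithCorners ℝ E H}
  {M : Type*} [TopologicalSpace M] [ChartedSpace H M] [IsManifold I ∞ M]

lemma mdifferentiableAt_inner (g : Metric I M) {X Y : Π x : M, TangentSpace I x} {x : M}
    (hX : MDiffAt (T% X) x) (hY : MDiffAt (T% Y) x) :
    MDiffAt (fun y => g.inner y (X y) (Y y)) x := by
  have h : MDifferentiableAt I (I.prod 𝓘(ℝ))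
      (fun m => TotalSpace.mk' ℝ (E := Bundle.Trivial M ℝ) m (g.inner m (X m) (Y m))) x := by
    apply MDifferentiableAt.clm_bundle_apply₂ (F₁ := E) (F₂ := E) _ hX hY
    exact g.contMDiff.mdifferentiableAt (by simp)
  rw [mdifferentiableAt_totalSpace] at h
  exact h.2

lemma contMDiffAt_inner (g : Metric I M) {X Y : Π x : M, TangentSpace I x} {x : M}
    (hX : CMDiffAt ∞ (T% X) x) (hY : CMDiffAt ∞ (T% Y) x) :
    CMDiffAt ∞ (fun y => g.inner y (X y) (Y y)) x := by
  have h : ContMDiffAt I (I.prod 𝓘(ℝ)) ∞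
      (fun m => TotalSpace.mk' ℝ (E := Bundle.Trivial M ℝ) m (g.inner m (X m) (Y m))) x := by
    apply ContMDiffAt.clm_bundle_apply₂ (F₁ := E) (F₂ := E) _ hX hY
    exact g.contMDiff.contMDiffAt
  rw [contMDiffAt_totalSpace] at h
  exact h.2

lemma contMDiffAt_extendVec {x : M} (v : TangentSpace I x) :
    CMDiffAt ∞ (T% (extendVec I v)) x :=
  FiberBundle.contMDiffAt_extend I E v

lemma mdifferentiableAt_extendVec {x : M} (v : TangentSpace I x) :
    MDiffAt (T% (extendVec I v)) x :=
  FiberBundle.mdifferentiableAt_extend I E v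

@[simp] lemma extendVec_self {x : M} (v : TangentSpace I x) : extendVec I v x = v :=
  FiberBundle.extend_apply_self E v

lemma extendVec_smul {x : M} (c : ℝ) (v : TangentSpace I x) :
    ∀ᶠ y in nhds x, extendVec I (c • v) y = c • extendVec I v y := by
  have hx := FiberBundle.mem_baseSet_trivializationAt' (F := E) (E := (TangentSpace I : M → Type _)) x
  filter_upwards [(trivializationAt E (TangentSpace I : M → Type _) x).open_baseSet.mem_nhds hx]
    with y hy
  unfold extendVec FiberBundle.extend
  have h := ((trivializationAt E (TangentSpace I : M → Type _) x).linear ℝ hx).map_smul c v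
  have h2 := ((trivializationAt E (TangentSpace I : M → Type _) x).symmₗ ℝ y).map_smul c
    ((trivializationAt E (TangentSpace I : M → Type _) x) ⟨x, v⟩).2
  rw [h]
  simpa only [Trivialization.symmₗ_apply _ hy] using h2

lemma tensorialAt_koszul_left (g : Metric I M) {Y Z : Π x : M, TangentSpace I x} {x : M}
    (hY : MDiffAt (T% Y) x) (hZ : MDiffAt (T% Z) x) :
    TensorialAt I E (fun X => koszul g X Y Z x) x where
  smul {f X} hf hX := by
    have : CompleteSpace E := FiniteDimensional.complete ℝ E
    simp only [koszul, Pi.smul_apply', map_smul, _root_.smul_apply, smul_eq_mul,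
      mlieBracket_smul_left hf hX, mvfderiv_fun_mul hf (mdifferentiableAt_inner g hX hZ),
      mvfderiv_fun_mul hf (mdifferentiableAt_inner g hX hY), _root_.add_apply,
      map_add, neg_smul, map_neg, _root_.neg_apply]
    ring
  add {X X'} hX hX' := by
    have : CompleteSpace E := FiniteDimensional.complete ℝ E
    simp only [koszul, Pi.add_apply, map_add, _root_.add_apply,
      mlieBracket_add_left hX hX', mvfderiv_fun_add (mdifferentiableAt_inner g hX hZ)
        (mdifferentiableAt_inner g hX' hZ), mvfderiv_fun_add (mdifferentiableAt_inner g hX hY)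
        (mdifferentiableAt_inner g hX' hY)]
    ring

lemma tensorialAt_koszul_right (g : Metric I M) {X Y : Π x : M, TangentSpace I x} {x : M}
    (hX : MDiffAt (T% X) x) (hY : MDiffAt (T% Y) x) :
    TensorialAt I E (fun Z => koszul g X Y Z x) x where
  smul {f Z} hf hZ := by
    have : CompleteSpace E := FiniteDimensional.complete ℝ E
    simp only [koszul, Pi.smul_apply', map_smul, _root_.smul_apply, smul_eq_mul,
      mlieBracket_smul_right hf hZ, mvfderiv_fun_mul hf (mdifferentiableAt_inner g hX hZ),
      mvfderiv_fun_mul hf (mdifferentiableAt_inner g hY hZ), _root_.add_apply,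
      map_add]
    rw [g.symm x (Z x), g.symm x (Z x)]
    ring
  add {Z Z'} hZ hZ' := by
    have : CompleteSpace E := FiniteDimensional.complete ℝ E
    simp only [koszul, Pi.add_apply, map_add, _root_.add_apply,
      mlieBracket_add_right hZ hZ', mvfderiv_fun_add (mdifferentiableAt_inner g hX hZ)
        (mdifferentiableAt_inner g hX hZ'), mvfderiv_fun_add (mdifferentiableAt_inner g hY hZ)
        (mdifferentiableAt_inner g hY hZ')]
    ring

/-- The Koszul expression at `x` as a bilinear form in its first and third arguments. -/
def koszulForm (g : Metric I M) {Y : Π x : M, TangentSpace I x} {x : M}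
    (hY : MDiffAt (T% Y) x) : TangentSpace I x →L[ℝ] TangentSpace I x →L[ℝ] ℝ :=
  TensorialAt.mkHom₂ (I := I) (F := E) (F' := E) (fun X Z => koszul g X Y Z x) x
    (fun _ hZ => tensorialAt_koszul_left g hY hZ) (fun _ hX => tensorialAt_koszul_right g hX hY)

lemma koszulForm_apply (g : Metric I M) {X Y Z : Π x : M, TangentSpace I x} {x : M}
    (hX : MDiffAt (T% X) x) (hY : MDiffAt (T% Y) x) (hZ : MDiffAt (T% Z) x) :
    koszulForm g hY (X x) (Z x) = koszul g X Y Z x :=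
  TensorialAt.mkHom₂_apply (I := I) (F := E) (F' := E) (Φ := fun X Z => koszul g X Y Z x)
    (fun _ hZ => tensorialAt_koszul_left g hY hZ)
    (fun _ hX => tensorialAt_koszul_right g hX hY) hX hZ

end OneManifold

section Gram

variable {V : Type*} [AddCommGroup V] [Module ℝ V] [TopologicalSpace V]
  {W : Type*} [AddCommGroup W] [Module ℝ W]
  {ι : Type*} [Fintype ι] [DecidableEq ι]

/-- The Gram matrix of a family of vectors. -/
def gram (g : V →L[ℝ] V →L[ℝ] ℝ) (b : ι → V) : Matrix ι ι ℝ := Matrix.of fun i j => g (b i) (b j)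

/-- The family `bⁱ = ∑ⱼ gⁱʲ bⱼ`. -/
def dualFamily (g : V →L[ℝ] V →L[ℝ] ℝ) (b : ι → V) (i : ι) : V := ∑ j, (gram g b)⁻¹ i j • b j

variable {g : V →L[ℝ] V →L[ℝ] ℝ} (hsymm : ∀ v w, g v w = g w v) (hpos : ∀ v, v ≠ 0 → 0 < g v v)
  (b : Module.Basis ι ℝ V)

include hpos in
lemma isUnit_det_gram : IsUnit (gram g b).det := by
  rw [isUnit_iff_ne_zero]
  intro h
  obtain ⟨v, hv, hv0⟩ := Matrix.exists_mulVec_eq_zero_iff.2 h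
  have h1 : ∀ w, w = ∑ i, v i • b i → g w w = 0 := by
    intro w hw
    have h2 : ∀ i, g (b i) w = 0 := fun i => by
      rw [hw]
      have := congrFun hv0 i
      simpa [Matrix.mulVec, dotProduct, gram, map_sum, mul_comm] using this
    have h3 : g w w = g (∑ i, v i • b i) w := by rw [← hw]
    rw [h3]
    simp [map_sum, h2]
  have h3 : ∑ i, v i • b i ≠ 0 := fun h0 => by
    apply hv
    funext i
    exact Fintype.linearIndependent_iff.1 b.linearIndependent v h0 i
  exact (hpos _ h3).ne' (h1 _ rfl)

include hsymm in
lemma gram_inv_symm (b : ι → V) (i j : ι) : (gram g b)⁻¹ i j = (gram g b)⁻¹ j i := by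
  have h : (gram g b).transpose = gram g b := by
    ext i j
    simp [gram, hsymm (b j) (b i)]
  conv_lhs => rw [← h, ← Matrix.transpose_nonsing_inv, Matrix.transpose_apply]

include hpos in
lemma inner_dualFamily_basis (i k : ι) :
    g (dualFamily g b i) (b k) = if i = k then 1 else 0 := by
  have h := congrFun (congrFun (Matrix.nonsing_inv_mul _ (isUnit_det_gram hpos b)) i) k
  rw [Matrix.mul_apply, Matrix.one_apply] at h
  simpa [dualFamily, gram] using h

include hpos in
lemma sum_inner_dualFamily_smul (v : V) : ∑ i, g (dualFamily g b i) v • b i = v := by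
  conv_rhs => rw [← b.sum_repr v]
  refine Finset.sum_congr rfl fun i _ => ?_
  congr 1
  conv_lhs => rw [← b.sum_repr v]
  rw [map_sum]
  simp only [map_smul, inner_dualFamily_basis hpos b, smul_eq_mul, mul_ite, mul_one, mul_zero]
  simp

include hpos hsymm in
lemma sum_inner_smul_dualFamily (v : V) : ∑ i, g (b i) v • dualFamily g b i = v := by
  conv_rhs => rw [← sum_inner_dualFamily_smul hpos b v]
  simp only [dualFamily, Finset.smul_sum, map_sum, map_smul, sum_apply,
    _root_.smul_apply, Finset.sum_smul, smul_eq_mul, smul_smul]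
  rw [Finset.sum_comm]
  refine Finset.sum_congr rfl fun i _ => Finset.sum_congr rfl fun j _ => ?_
  rw [gram_inv_symm hsymm b j i, mul_comm]

/-- The trace of a bilinear map with respect to a scalar product, computed in a basis. -/
def bilinTrace (g : V →L[ℝ] V →L[ℝ] ℝ) (b : ι → V) (B : ι → ι → W) : W :=
  ∑ i, ∑ j, (gram g b)⁻¹ i j • B i j

lemma bilinTrace_eq (b : ι → V) (B : V →ₗ[ℝ] V →ₗ[ℝ] W) :
    bilinTrace g b (fun i j => B (b i) (b j)) = ∑ i, B (b i) (dualFamily g b i) := by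
  simp [bilinTrace, dualFamily]

include hpos hsymm in
/-- The trace does not depend on the basis. -/
lemma bilinTrace_basis_eq {ι' : Type*} [Fintype ι'] [DecidableEq ι'] (b' : Module.Basis ι' ℝ V)
    (B : V →ₗ[ℝ] V →ₗ[ℝ] W) :
    bilinTrace g b' (fun i j => B (b' i) (b' j)) = bilinTrace g b (fun i j => B (b i) (b j)) := by
  rw [bilinTrace_eq, bilinTrace_eq]
  calc ∑ i, B (b' i) (dualFamily g b' i)
      = ∑ i, B (∑ k, g (dualFamily g b k) (b' i) • b k) (dualFamily g b' i) := by
        simp only [sum_inner_dualFamily_smul hpos b]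
    _ = ∑ k, B (b k) (∑ i, g (b' i) (dualFamily g b k) • dualFamily g b' i) := by
        simp only [map_sum, map_smul, LinearMap.sum_apply, LinearMap.smul_apply]
        rw [Finset.sum_comm]
        simp only [hsymm (b' _)]
    _ = _ := by simp only [sum_inner_smul_dualFamily hsymm hpos b']

end Gram

section OneManifold

variable {E : Type*} [NormedAddCommGroup E] [NormedSpace ℝ E] [FiniteDimensional ℝ E]
  {H : Type*} [TopologicalSpace H] {I : ModelWithCorners ℝ E H}
  {M : Type*} [TopologicalSpace M] [ChartedSpace H M] [IsManifold I ∞ M]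

variable (I) in
/-- The domain of the coordinate frame `frame I p`. -/
def frameDomain (p : M) : Set M := (trivializationAt E (TangentSpace I : M → Type _) p).baseSet

lemma isOpen_frameDomain (p : M) : IsOpen (frameDomain I p) :=
  (trivializationAt E (TangentSpace I : M → Type _) p).open_baseSet

lemma mem_frameDomain (p : M) : p ∈ frameDomain I p :=
  FiberBundle.mem_baseSet_trivializationAt' p

/-- The coordinate frame at a point of its domain, as a basis of the tangent space. -/
def frameBasis {p x : M} (hx : x ∈ frameDomain I p) :
    Module.Basis (Fin (Module.finrank ℝ E)) ℝ (TangentSpace I x) :=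
  (trivializationAt E (TangentSpace I : M → Type _) p).basisAt (Module.finBasis ℝ E) hx

@[simp] lemma frameBasis_apply {p x : M} (hx : x ∈ frameDomain I p)
    (i : Fin (Module.finrank ℝ E)) : frameBasis hx i = frame I p i x :=
  ((trivializationAt E (TangentSpace I : M → Type _) p).localFrame_apply_of_mem_baseSet
    (Module.finBasis ℝ E) hx).symm

lemma frameBasis_coe {p x : M} (hx : x ∈ frameDomain I p) :
    ⇑(frameBasis hx) = fun i => frame I p i x := funext fun i => frameBasis_apply hx i

lemma contMDiffAt_frame {p x : M} (hx : x ∈ frameDomain I p) (i : Fin (Module.finrank ℝ E)) :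
    CMDiffAt ∞ (T% (frame I p i)) x :=
  contMDiffAt_localFrame_of_mem ∞ (trivializationAt E (TangentSpace I : M → Type _) p)
    (Module.finBasis ℝ E) i hx

lemma mdifferentiableAt_frame {p x : M} (hx : x ∈ frameDomain I p)
    (i : Fin (Module.finrank ℝ E)) : MDiffAt (T% (frame I p i)) x :=
  (contMDiffAt_frame hx i).mdifferentiableAt (by simp)

lemma frameCoeff_eq_repr {p x : M} (hx : x ∈ frameDomain I p) (i : Fin (Module.finrank ℝ E))
    (v : TangentSpace I x) : frameCoeff I p i x v = (frameBasis hx).repr v i := by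
  have := (trivializationAt E (TangentSpace I : M → Type _) p).localFrameCoeff_apply_of_mem_baseSet
    (I := I) (Module.finBasis ℝ E) hx (extendVec I v) i
  rw [extendVec_self] at this
  exact this

lemma frameCoeff_add (p : M) (i : Fin (Module.finrank ℝ E)) (x : M) (v w : TangentSpace I x) :
    frameCoeff I p i x (v + w) = frameCoeff I p i x v + frameCoeff I p i x w :=
  map_add _ _ _

lemma frameCoeff_smul (p : M) (i : Fin (Module.finrank ℝ E)) (x : M) (c : ℝ)
    (v : TangentSpace I x) : frameCoeff I p i x (c • v) = c * frameCoeff I p i x v :=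
  map_smul _ _ _

lemma sum_frameCoeff_smul_frame {p x : M} (hx : x ∈ frameDomain I p) (v : TangentSpace I x) :
    ∑ i, frameCoeff I p i x v • frame I p i x = v := by
  simp only [frameCoeff_eq_repr hx, ← frameBasis_apply hx]
  exact (frameBasis hx).sum_repr v

lemma invGram_eq (g : Metric I M) (x : M) :
    invGram g x = (gram (g.inner x) (fun i => frame I x i x))⁻¹ := rfl

lemma invGram_symm (g : Metric I M) (x : M) (i j : Fin (Module.finrank ℝ E)) :
    invGram g x i j = invGram g x j i := gram_inv_symm (g.symm x) _ i j

/-- A formula for `sharp` in an arbitrary basis. -/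
lemma sharp_eq (g : Metric I M) {x : M} (α : TangentSpace I x →ₗ[ℝ] ℝ) :
    sharp g x α = ∑ i, α (frame I x i x) • dualFamily (g.inner x) (fun i => frame I x i x) i := by
  simp only [sharp, dualFamily, Finset.smul_sum, smul_smul, ← invGram_eq]
  simp only [mul_comm]

lemma inner_sharp (g : Metric I M) {x : M} (α : TangentSpace I x →ₗ[ℝ] ℝ)
    (v : TangentSpace I x) : g.inner x (sharp g x α) v = α v := by
  have hx := mem_frameDomain (I := I) x
  rw [sharp_eq, ← frameBasis_coe hx]
  conv_rhs => rw [← sum_inner_dualFamily_smul (g.pos x) (frameBasis hx) v]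
  simp [mul_comm]

lemma ext_inner (g : Metric I M) {x : M} {v w : TangentSpace I x}
    (h : ∀ z, g.inner x v z = g.inner x w z) : v = w := by
  by_contra hne
  have h1 := g.pos x (v - w) (sub_ne_zero.2 hne)
  have h2 : g.inner x (v - w) (v - w) = 0 := by
    rw [map_sub (g.inner x) v w, sub_apply, h, sub_self]
  exact h1.ne' h2

lemma sharp_congr (g : Metric I M) {x : M} {α β : TangentSpace I x → ℝ} (h : ∀ v, α v = β v) :
    sharp g x α = sharp g x β := by rw [funext h]

lemma leviCivita_eq_sharp (g : Metric I M) {Y : Π x : M, TangentSpace I x} {x : M}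
    (hY : MDiffAt (T% Y) x) (v : TangentSpace I x) :
    leviCivita g Y x v = sharp g x (((1 / 2 : ℝ) • koszulForm g hY v : TangentSpace I x →L[ℝ] ℝ) :
      TangentSpace I x →ₗ[ℝ] ℝ) := by
  refine sharp_congr g fun z => ?_
  have h := koszulForm_apply g (mdifferentiableAt_extendVec v) hY (mdifferentiableAt_extendVec z)
  rw [extendVec_self, extendVec_self] at h
  simp [h]
  ring

lemma inner_leviCivita_eq_koszulForm (g : Metric I M) {Y : Π x : M, TangentSpace I x} {x : M}
    (hY : MDiffAt (T% Y) x) (v z : TangentSpace I x) :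
    g.inner x (leviCivita g Y x v) z = koszulForm g hY v z / 2 := by
  rw [leviCivita_eq_sharp g hY, inner_sharp]
  simp
  ring

/-- The Koszul formula. -/
lemma inner_leviCivita (g : Metric I M) {X Y Z : Π x : M, TangentSpace I x} {x : M}
    (hX : MDiffAt (T% X) x) (hY : MDiffAt (T% Y) x) (hZ : MDiffAt (T% Z) x) :
    g.inner x (leviCivita g Y x (X x)) (Z x) = koszul g X Y Z x / 2 := by
  rw [inner_leviCivita_eq_koszulForm g hY, koszulForm_apply g hX hY hZ]

/-- Covariant derivative as a linear map of the direction. -/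
lemma leviCivita_add_dir (g : Metric I M) {Y : Π x : M, TangentSpace I x} {x : M}
    (hY : MDiffAt (T% Y) x) (v w : TangentSpace I x) :
    leviCivita g Y x (v + w) = leviCivita g Y x v + leviCivita g Y x w := by
  refine ext_inner g fun z => ?_
  simp only [map_add, add_apply, inner_leviCivita_eq_koszulForm g hY]
  ring

lemma leviCivita_smul_dir (g : Metric I M) {Y : Π x : M, TangentSpace I x} {x : M}
    (hY : MDiffAt (T% Y) x) (c : ℝ) (v : TangentSpace I x) :
    leviCivita g Y x (c • v) = c • leviCivita g Y x v := by
  refine ext_inner g fun z => ?_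
  simp only [map_smul, smul_apply, inner_leviCivita_eq_koszulForm g hY, smul_eq_mul]
  ring

lemma mvfderiv_congr {f f' : M → ℝ} {x : M} (h : f =ᶠ[nhds x] f') :
    mvfderiv I f x = mvfderiv I f' x := by
  unfold mvfderiv
  have h1 := h.self_of_nhds
  ext v
  simp only [ContinuousLinearMap.comp_apply]
  rw [h.mfderiv_eq, h1]

lemma leviCivita_congr (g : Metric I M) {Y Y' : Π x : M, TangentSpace I x} {x : M}
    (h : ∀ᶠ y in nhds x, Y y = Y' y) (v : TangentSpace I x) :
    leviCivita g Y x v = leviCivita g Y' x v := by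
  refine sharp_congr g fun z => ?_
  have h0 := h.self_of_nhds
  have h1 : ∀ U : Π x : M, TangentSpace I x,
      mlieBracket I U Y x = mlieBracket I U Y' x := fun U =>
    Filter.EventuallyEq.mlieBracket_vectorField_eq (Filter.EventuallyEq.refl _ _) h
  have h2 : ∀ U : Π x : M, TangentSpace I x,
      mlieBracket I Y U x = mlieBracket I Y' U x := fun U =>
    Filter.EventuallyEq.mlieBracket_vectorField_eq h (Filter.EventuallyEq.refl _ _)
  simp only [koszul, h1, h2, h0]
  rw [mvfderiv_congr (h.mono fun y hy => show g.inner y (Y y) (extendVec I z y) =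
      g.inner y (Y' y) (extendVec I z y) by rw [hy]),
    mvfderiv_congr (h.mono fun y hy => show g.inner y (extendVec I v y) (Y y) =
      g.inner y (extendVec I v y) (Y' y) by rw [hy])]

lemma leviCivita_add (g : Metric I M) {Y Y' : Π x : M, TangentSpace I x} {x : M}
    (hY : MDiffAt (T% Y) x) (hY' : MDiffAt (T% Y') x) (v : TangentSpace I x) :
    leviCivita g (fun y => Y y + Y' y) x v = leviCivita g Y x v + leviCivita g Y' x v := by
  have : CompleteSpace E := FiniteDimensional.complete ℝ E
  have hs : MDiffAt (T% (fun y => Y y + Y' y)) x := mdifferentiableAt_add_section hY hY'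
  refine ext_inner g fun z => ?_
  have hv := mdifferentiableAt_extendVec v
  have hz := mdifferentiableAt_extendVec z
  have e1 := inner_leviCivita g hv hs hz
  have e2 := inner_leviCivita g hv hY hz
  have e3 := inner_leviCivita g hv hY' hz
  rw [extendVec_self, extendVec_self] at e1 e2 e3
  rw [map_add, add_apply, e1, e2, e3]
  have b1 := mlieBracket_add_right (V := extendVec I v) hY hY'
  have b2 := mlieBracket_add_left (W := extendVec I z) hY hY'
  change mlieBracket I _ (fun y => Y y + Y' y) x = _ at b1
  change mlieBracket I (fun y => Y y + Y' y) _ x = _ at b2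
  simp only [koszul, b1, b2, map_add, add_apply,
    mvfderiv_fun_add (mdifferentiableAt_inner g hY hz) (mdifferentiableAt_inner g hY' hz),
    mvfderiv_fun_add (mdifferentiableAt_inner g hv hY) (mdifferentiableAt_inner g hv hY')]
  ring

lemma leviCivita_smul (g : Metric I M) {f : M → ℝ} {Y : Π x : M, TangentSpace I x} {x : M}
    (hf : MDiffAt f x) (hY : MDiffAt (T% Y) x) (v : TangentSpace I x) :
    leviCivita g (fun y => f y • Y y) x v = mvfderiv I f x v • Y x + f x • leviCivita g Y x v := by
  have : CompleteSpace E := FiniteDimensional.complete ℝ E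
  have hs : MDiffAt (T% (fun y => f y • Y y)) x := hf.smul_section hY
  refine ext_inner g fun z => ?_
  have hv := mdifferentiableAt_extendVec v
  have hz := mdifferentiableAt_extendVec z
  have e1 := inner_leviCivita g hv hs hz
  have e2 := inner_leviCivita g hv hY hz
  rw [extendVec_self, extendVec_self] at e1 e2
  rw [map_add, add_apply, map_smul, map_smul, smul_apply, smul_apply, e1, e2]
  have b1 := mlieBracket_smul_right (V := extendVec I v) hf hY
  have b2 := mlieBracket_smul_left (W := extendVec I z) hf hY
  change mlieBracket I _ (fun y => f y • Y y) x = _ at b1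
  change mlieBracket I (fun y => f y • Y y) _ x = _ at b2
  simp only [koszul, b1, b2, map_add, add_apply, map_smul, smul_apply, smul_eq_mul, neg_smul,
    map_neg, neg_apply, extendVec_self,
    mvfderiv_fun_mul hf (mdifferentiableAt_inner g hY hz),
    mvfderiv_fun_mul hf (mdifferentiableAt_inner g hv hY)]
  rw [g.symm x (Y x) v]
  ring

end OneManifold

section Along

variable {E : Type*} [NormedAddCommGroup E] [NormedSpace ℝ E] [FiniteDimensional ℝ E]
  {H : Type*} [TopologicalSpace H] {I : ModelWithCorners ℝ E H}
  {M : Type*} [TopologicalSpace M] [ChartedSpace H M] [IsManifold I ∞ M]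
  {E' : Type*} [NormedAddCommGroup E'] [NormedSpace ℝ E'] [FiniteDimensional ℝ E']
  {H' : Type*} [TopologicalSpace H'] {J : ModelWithCorners ℝ E' H'}
  {N : Type*} [TopologicalSpace N] [ChartedSpace H' N] [IsManifold J ∞ N]

variable (I J) in
/-- Smoothness at `x` of a vector field along a map. -/
def SmoothAlong (φ : M → N) (V : Π x : M, TangentSpace J (φ x)) (x : M) : Prop :=
  ContMDiffAt I J.tangent ∞ (fun y => (⟨φ y, V y⟩ : TangentBundle J N)) x

variable (I J) in
/-- Differentiability at `x` of a vector field along a map. -/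
def DiffAlong (φ : M → N) (V : Π x : M, TangentSpace J (φ x)) (x : M) : Prop :=
  MDifferentiableAt I J.tangent (fun y => (⟨φ y, V y⟩ : TangentBundle J N)) x

lemma SmoothAlong.diffAlong {φ : M → N} {V : Π x : M, TangentSpace J (φ x)} {x : M}
    (h : SmoothAlong I J φ V x) : DiffAlong I J φ V x :=
  ContMDiffAt.mdifferentiableAt h (by simp)

lemma SmoothAlong.eventually_diffAlong {φ : M → N} {V : Π x : M, TangentSpace J (φ x)} {x : M}
    (h : SmoothAlong I J φ V x) : ∀ᶠ y in nhds x, DiffAlong I J φ V y := by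
  have h1 : ContMDiffAt I J.tangent 1 (fun y => (⟨φ y, V y⟩ : TangentBundle J N)) x :=
    ContMDiffAt.of_le h (by simp)
  filter_upwards [(contMDiffAt_iff_contMDiffAt_nhds (by simp)).1 h1] with y hy
  exact ContMDiffAt.mdifferentiableAt hy one_ne_zero

lemma frameCoeff_eq_repr_trivialization {p x : M} (hx : x ∈ frameDomain I p)
    (i : Fin (Module.finrank ℝ E)) (v : TangentSpace I x) :
    frameCoeff I p i x v = (Module.finBasis ℝ E).repr
      ((trivializationAt E (TangentSpace I : M → Type _) p) ⟨x, v⟩).2 i := by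
  have := Trivialization.localFrameCoeff_eq_coeff (I := I) (s := extendVec I v)
    (b := Module.finBasis ℝ E)
    (trivializationAt E (TangentSpace I : M → Type _) p) hx (i := i)
  simpa only [extendVec_self] using! this

/-- Vector-valued smoothness, in a basis. -/
lemma contMDiffAt_iff_repr {ι : Type*} [Fintype ι] (b : Module.Basis ι ℝ E') {f : M → E'} {x : M} :
    ContMDiffAt I 𝓘(ℝ, E') ∞ f x ↔ ∀ i, ContMDiffAt I 𝓘(ℝ, ℝ) ∞ (fun y => b.repr (f y) i) x := by
  constructor
  · intro h i
    have h1 : ContMDiffAt 𝓘(ℝ, E') 𝓘(ℝ, ℝ) ∞ (b.coord i).toContinuousLinearMap (f x) :=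
      (ContinuousLinearMap.contMDiff _).contMDiffAt
    exact h1.comp x h
  · intro h
    have h1 : f = fun y => ∑ i, b.repr (f y) i • b i := funext fun y => (b.sum_repr (f y)).symm
    rw [h1]
    exact ContMDiffAt.sum fun i _ => (h i).smul contMDiffAt_const

lemma mdifferentiableAt_iff_repr {ι : Type} [Fintype ι] (b : Module.Basis ι ℝ E') {f : M → E'}
    {x : M} : MDifferentiableAt I 𝓘(ℝ, E') f x ↔
      ∀ i, MDifferentiableAt I 𝓘(ℝ, ℝ) (fun y => b.repr (f y) i) x := by
  constructor
  · intro h i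
    have h1 : MDifferentiableAt 𝓘(ℝ, E') 𝓘(ℝ, ℝ) (b.coord i).toContinuousLinearMap (f x) :=
      ((ContinuousLinearMap.contMDiff (n := 1) _).contMDiffAt).mdifferentiableAt one_ne_zero
    exact h1.comp x h
  · intro h
    have h1 : f = ∑ i, fun y => b.repr (f y) i • b i := by
      funext y
      rw [Finset.sum_apply]
      exact (b.sum_repr (f y)).symm
    rw [h1]
    refine MDifferentiableAt.sum (f := fun (i : ι) y => b.repr (f y) i • b i) (t := Finset.univ)
      fun i _ => ?_
    exact (h i).smul (mdifferentiableAt_const (c := b i))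

lemma eventually_mem_frameDomain {φ : M → N} {x : M} (hφ : ContinuousAt φ x) {p : N}
    (hp : φ x ∈ frameDomain J p) : ∀ᶠ y in nhds x, φ y ∈ frameDomain J p :=
  hφ ((isOpen_frameDomain p).mem_nhds hp)

lemma smoothAlong_iff {φ : M → N} {V : Π x : M, TangentSpace J (φ x)} {x : M}
    (hφ : CMDiffAt ∞ φ x) {p : N} (hp : φ x ∈ frameDomain J p) :
    SmoothAlong I J φ V x ↔
      ∀ a, ContMDiffAt I 𝓘(ℝ, ℝ) ∞ (fun y => frameCoeff J p a (φ y) (V y)) x := by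
  rw [SmoothAlong, (trivializationAt E' (TangentSpace J : N → Type _) p).contMDiffAt_iff
    (f := fun y => (⟨φ y, V y⟩ : TangentBundle J N)) ((Trivialization.mem_source _).2 hp),
    and_iff_right (show CMDiffAt ∞ φ x from hφ), contMDiffAt_iff_repr (Module.finBasis ℝ E')]
  refine forall_congr' fun a => Filter.EventuallyEq.contMDiffAt_iff ?_
  filter_upwards [eventually_mem_frameDomain hφ.continuousAt hp] with y hy
  exact (frameCoeff_eq_repr_trivialization hy a (V y)).symm

lemma diffAlong_iff {φ : M → N} {V : Π x : M, TangentSpace J (φ x)} {x : M}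
    (hφ : MDiffAt φ x) {p : N} (hp : φ x ∈ frameDomain J p) :
    DiffAlong I J φ V x ↔
      ∀ a, MDifferentiableAt I 𝓘(ℝ, ℝ) (fun y => frameCoeff J p a (φ y) (V y)) x := by
  rw [DiffAlong, Trivialization.mdifferentiableAt_totalSpace_iff J
    (trivializationAt E' (TangentSpace J : N → Type _) p)
    (fun y => (⟨φ y, V y⟩ : TangentBundle J N)) ((Trivialization.mem_source _).2 hp),
    and_iff_right (show MDiffAt φ x from hφ),
    mdifferentiableAt_iff_repr (Module.finBasis ℝ E')]
  refine forall_congr' fun a => Filter.EventuallyEq.mdifferentiableAt_iff ?_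
  filter_upwards [eventually_mem_frameDomain hφ.continuousAt hp] with y hy
  exact (frameCoeff_eq_repr_trivialization hy a (V y)).symm

lemma SmoothAlong.add {φ : M → N} {V W : Π x : M, TangentSpace J (φ x)} {x : M}
    (hφ : CMDiffAt ∞ φ x) (hV : SmoothAlong I J φ V x) (hW : SmoothAlong I J φ W x) :
    SmoothAlong I J φ (fun y => V y + W y) x := by
  rw [smoothAlong_iff hφ (mem_frameDomain _)] at *
  intro a
  simp only [frameCoeff_add]
  exact (hV a).add (hW a)

lemma SmoothAlong.smul {φ : M → N} {V : Π x : M, TangentSpace J (φ x)} {f : M → ℝ} {x : M}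
    (hφ : CMDiffAt ∞ φ x) (hf : CMDiffAt ∞ f x) (hV : SmoothAlong I J φ V x) :
    SmoothAlong I J φ (fun y => f y • V y) x := by
  rw [smoothAlong_iff hφ (mem_frameDomain _)] at *
  intro a
  simp only [frameCoeff_smul]
  exact hf.mul (hV a)

lemma SmoothAlong.sum {φ : M → N} {ι : Type*} {s : Finset ι}
    {V : ι → Π x : M, TangentSpace J (φ x)} {x : M}
    (hφ : CMDiffAt ∞ φ x) (hV : ∀ i ∈ s, SmoothAlong I J φ (V i) x) :
    SmoothAlong I J φ (fun y => ∑ i ∈ s, V i y) x := by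
  simp only [smoothAlong_iff hφ (mem_frameDomain _)] at *
  intro a
  have h : ∀ y, frameCoeff J (φ x) a (φ y) (∑ i ∈ s, V i y) =
      ∑ i ∈ s, frameCoeff J (φ x) a (φ y) (V i y) := fun y => map_sum
        ((trivializationAt E' (TangentSpace J : N → Type _) (φ x)).localFrameCoeff J
          (Module.finBasis ℝ E') a (φ y)) _ _
  simp only [h]
  exact ContMDiffAt.sum fun i hi => hV i hi a

lemma DiffAlong.add {φ : M → N} {V W : Π x : M, TangentSpace J (φ x)} {x : M}
    (hφ : MDiffAt φ x) (hV : DiffAlong I J φ V x) (hW : DiffAlong I J φ W x) :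
    DiffAlong I J φ (fun y => V y + W y) x := by
  rw [diffAlong_iff hφ (mem_frameDomain _)] at *
  intro a
  simp only [frameCoeff_add]
  exact (hV a).add (hW a)

lemma DiffAlong.smul {φ : M → N} {V : Π x : M, TangentSpace J (φ x)} {f : M → ℝ} {x : M}
    (hφ : MDiffAt φ x) (hf : MDiffAt f x) (hV : DiffAlong I J φ V x) :
    DiffAlong I J φ (fun y => f y • V y) x := by
  rw [diffAlong_iff hφ (mem_frameDomain _)] at *
  intro a
  simp only [frameCoeff_smul]
  exact hf.mul (hV a)

lemma SmoothAlong.congr {φ : M → N} {V W : Π x : M, TangentSpace J (φ x)} {x : M}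
    (hV : SmoothAlong I J φ V x) (h : ∀ᶠ y in nhds x, W y = V y) : SmoothAlong I J φ W x := by
  refine ContMDiffAt.congr_of_eventuallyEq hV ?_
  filter_upwards [h] with y hy
  rw [hy]

lemma smoothAlong_comp {φ : M → N} {Y : Π z : N, TangentSpace J z} {x : M}
    (hφ : CMDiffAt ∞ φ x) (hY : CMDiffAt ∞ (T% Y) (φ x)) :
    SmoothAlong I J φ (fun y => Y (φ y)) x :=
  ContMDiffAt.comp (g := fun z => (⟨z, Y z⟩ : TangentBundle J N)) x hY hφ

lemma smoothAlong_mfderiv {φ : M → N} {X : Π x : M, TangentSpace I x} {x : M}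
    (hφ : CMDiffAt ∞ φ x) (hX : CMDiffAt ∞ (T% X) x) :
    SmoothAlong I J φ (fun y => mfderiv I J φ y (X y)) x := by
  have h := hφ.mfderiv_const (m := ∞) le_rfl
  exact ContMDiffAt.clm_apply_of_inCoordinates h hX hφ

lemma diffAlong_mfderiv {φ : M → N} {X : Π x : M, TangentSpace I x} {x : M}
    (hφ : ContMDiff I J ∞ φ) (hX : MDiffAt (T% X) x) :
    DiffAlong I J φ (fun y => mfderiv I J φ y (X y)) x := by
  have h := (hφ.contMDiff_tangentMap (m := ∞) le_rfl).mdifferentiable (by simp)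
  exact (h ⟨x, X x⟩).comp x hX

lemma contMDiffAt_mvfderiv {f : M → ℝ} {X : Π x : M, TangentSpace I x} {x : M}
    (hf : CMDiffAt ∞ f x) (hX : CMDiffAt ∞ (T% X) x) :
    CMDiffAt ∞ (fun y => mvfderiv I f y (X y)) x := by
  have h := smoothAlong_mfderiv (J := 𝓘(ℝ, ℝ)) hf hX
  have h2 := (contMDiffAt_totalSpace.1 h).2
  simp only [mfld_simps] at h2
  exact h2

end Along

section Smooth

variable {E : Type*} [NormedAddCommGroup E] [NormedSpace ℝ E] [FiniteDimensional ℝ E]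
  {H : Type*} [TopologicalSpace H] {I : ModelWithCorners ℝ E H}
  {M : Type*} [TopologicalSpace M] [ChartedSpace H M] [IsManifold I ∞ M]

lemma contMDiffAt_det {ι : Type*} [Fintype ι] [DecidableEq ι] {A : M → Matrix ι ι ℝ} {x : M}
    (hA : ∀ i j, CMDiffAt ∞ (fun y => A y i j) x) : CMDiffAt ∞ (fun y => (A y).det) x := by
  simp only [Matrix.det_apply']
  exact ContMDiffAt.sum fun σ _ => contMDiffAt_const.mul (contMDiffAt_finsetProd fun i _ => hA _ _)

lemma contMDiffAt_matrix_inv {ι : Type*} [Fintype ι] [DecidableEq ι] {A : M → Matrix ι ι ℝ}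
    {x : M} (hA : ∀ i j, CMDiffAt ∞ (fun y => A y i j) x) (hx : IsUnit (A x).det) (i j : ι) :
    CMDiffAt ∞ (fun y => (A y)⁻¹ i j) x := by
  simp only [Matrix.inv_def, Matrix.smul_apply, Ring.inverse_eq_inv', smul_eq_mul,
    Matrix.adjugate_apply]
  refine ((contMDiffAt_det hA).inv₀ hx.ne_zero).mul (contMDiffAt_det fun k l => ?_)
  by_cases hk : k = j
  · subst hk
    simpa using contMDiffAt_const
  · simpa [Matrix.updateRow_ne hk] using hA k l

lemma contMDiffAt_gram_inv (g : Metric I M) {p x : M} (hx : x ∈ frameDomain I p)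
    (i j : Fin (Module.finrank ℝ E)) :
    CMDiffAt ∞ (fun y => (gram (g.inner y) (fun k => frame I p k y))⁻¹ i j) x := by
  refine contMDiffAt_matrix_inv (fun k l => ?_) ?_ i j
  · exact contMDiffAt_inner g (contMDiffAt_frame hx k) (contMDiffAt_frame hx l)
  · rw [← frameBasis_coe hx]
    exact isUnit_det_gram (g.pos x) (frameBasis hx)

lemma contMDiffAt_dualFamily (g : Metric I M) {p x : M} (hx : x ∈ frameDomain I p)
    (i : Fin (Module.finrank ℝ E)) :
    CMDiffAt ∞ (T% (fun y => dualFamily (g.inner y) (fun k => frame I p k y) i)) x :=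
  ContMDiffAt.sum_section fun j _ =>
    (contMDiffAt_gram_inv g hx i j).smul_section (contMDiffAt_frame hx j)

lemma contMDiffAt_mlieBracket {X Y : Π x : M, TangentSpace I x} {x : M}
    (hX : CMDiffAt ∞ (T% X) x) (hY : CMDiffAt ∞ (T% Y) x) :
    CMDiffAt ∞ (T% (mlieBracket I X Y)) x := by
  have : CompleteSpace E := FiniteDimensional.complete ℝ E
  have : IsManifold I (((⊤ : ℕ∞) : WithTop ℕ∞) + 1) M := by
    simpa using (inferInstance : IsManifold I ∞ M)
  have : IsManifold I (minSmoothness ℝ 2) M := by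
    rw [minSmoothness_of_isRCLikeNormedField]
    infer_instance
  have : IsManifold I (minSmoothness ℝ 3) M := by
    rw [minSmoothness_of_isRCLikeNormedField]
    infer_instance
  exact ContMDiffAt.mlieBracket_vectorField (m := ⊤) (n := ⊤) hX hY (by simp)

lemma contMDiffAt_koszul (g : Metric I M) {X Y Z : Π x : M, TangentSpace I x} {x : M}
    (hX : CMDiffAt ∞ (T% X) x) (hY : CMDiffAt ∞ (T% Y) x) (hZ : CMDiffAt ∞ (T% Z) x) :
    CMDiffAt ∞ (fun y => koszul g X Y Z y) x := by
  unfold koszul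
  exact (((((contMDiffAt_mvfderiv (contMDiffAt_inner g hY hZ) hX).add
    (contMDiffAt_mvfderiv (contMDiffAt_inner g hX hZ) hY)).sub
    (contMDiffAt_mvfderiv (contMDiffAt_inner g hX hY) hZ)).add
    (contMDiffAt_inner g (contMDiffAt_mlieBracket hX hY) hZ)).sub
    (contMDiffAt_inner g (contMDiffAt_mlieBracket hX hZ) hY)).sub
    (contMDiffAt_inner g (contMDiffAt_mlieBracket hY hZ) hX)

lemma eventually_mdifferentiableAt_section {X : Π x : M, TangentSpace I x} {x : M}
    (hX : CMDiffAt ∞ (T% X) x) : ∀ᶠ y in nhds x, MDiffAt (T% X) y :=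
  SmoothAlong.eventually_diffAlong (φ := id) hX

lemma contMDiffAt_section_congr {X Y : Π x : M, TangentSpace I x} {x : M}
    (hX : CMDiffAt ∞ (T% X) x) (h : ∀ᶠ y in nhds x, Y y = X y) : CMDiffAt ∞ (T% Y) x :=
  SmoothAlong.congr (φ := id) hX h

lemma contMDiffAt_leviCivita (g : Metric I M) {X Y : Π x : M, TangentSpace I x} {x : M}
    (hX : CMDiffAt ∞ (T% X) x) (hY : CMDiffAt ∞ (T% Y) x) :
    CMDiffAt ∞ (T% (fun y => leviCivita g Y y (X y))) x := by
  have h : CMDiffAt ∞ (T% (fun y => ∑ i, (koszul g X Y (frame I x i) y / 2) •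
      dualFamily (g.inner y) (fun k => frame I x k y) i)) x :=
    ContMDiffAt.sum_section fun i _ => ContMDiffAt.smul_section
      ((contMDiffAt_koszul g hX hY (contMDiffAt_frame (mem_frameDomain x) i)).div_const 2)
      (contMDiffAt_dualFamily g (mem_frameDomain x) i)
  refine contMDiffAt_section_congr h ?_
  filter_upwards [eventually_mdifferentiableAt_section hX, eventually_mdifferentiableAt_section hY,
    (isOpen_frameDomain (I := I) x).mem_nhds (mem_frameDomain x)] with y hXy hYy hy
  rw [← sum_inner_smul_dualFamily (g.symm y) (g.pos y) (frameBasis hy)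
    (leviCivita g Y y (X y))]
  rw [frameBasis_coe hy]
  refine Finset.sum_congr rfl fun i _ => ?_
  rw [g.symm y, inner_leviCivita g hXy hYy (mdifferentiableAt_frame hy i)]

lemma leviCivita_zero (g : Metric I M) {x : M} (v : TangentSpace I x) :
    leviCivita g (fun _ => 0) x v = 0 := by
  have h := leviCivita_smul g (f := fun _ => (0 : ℝ)) (Y := fun y => extendVec I v y)
    mdifferentiableAt_const (mdifferentiableAt_extendVec v) v
  simpa [mvfderiv_const] using h

lemma leviCivita_sum (g : Metric I M) {ι : Type*} (s : Finset ι)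
    {Y : ι → Π x : M, TangentSpace I x} {x : M}
    (hY : ∀ i ∈ s, MDiffAt (T% (Y i)) x) (v : TangentSpace I x) :
    leviCivita g (fun y => ∑ i ∈ s, Y i y) x v = ∑ i ∈ s, leviCivita g (Y i) x v := by
  classical
  induction s using Finset.induction_on with
  | empty => simpa using leviCivita_zero g v
  | insert i s hi ih =>
    simp only [Finset.sum_insert hi]
    rw [leviCivita_add g (hY i (Finset.mem_insert_self i s))
      (MDifferentiableAt.sum_section fun j hj => hY j (Finset.mem_insert_of_mem hj)),
      ih fun j hj => hY j (Finset.mem_insert_of_mem hj)]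

end Smooth

section Pullback

variable {E : Type*} [NormedAddCommGroup E] [NormedSpace ℝ E] [FiniteDimensional ℝ E]
  {H : Type*} [TopologicalSpace H] {I : ModelWithCorners ℝ E H}
  {M : Type*} [TopologicalSpace M] [ChartedSpace H M] [IsManifold I ∞ M]
  {E' : Type*} [NormedAddCommGroup E'] [NormedSpace ℝ E'] [FiniteDimensional ℝ E']
  {H' : Type*} [TopologicalSpace H'] {J : ModelWithCorners ℝ E' H'}
  {N : Type*} [TopologicalSpace N] [ChartedSpace H' N] [IsManifold J ∞ N]
  (h : Metric J N) {φ : M → N} {V W : Π x : M, TangentSpace J (φ x)} {x : M}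

lemma pullbackConn_add_dir (v w : TangentSpace I x) :
    pullbackConn I h φ V x (v + w) = pullbackConn I h φ V x v + pullbackConn I h φ V x w := by
  simp only [pullbackConn, map_add, ← Finset.sum_add_distrib,
    leviCivita_add_dir h (mdifferentiableAt_frame (mem_frameDomain (φ x)) _)]
  refine Finset.sum_congr rfl fun a _ => ?_
  module

lemma pullbackConn_smul_dir (c : ℝ) (v : TangentSpace I x) :
    pullbackConn I h φ V x (c • v) = c • pullbackConn I h φ V x v := by
  simp only [pullbackConn, map_smul, Finset.smul_sum,
    leviCivita_smul_dir h (mdifferentiableAt_frame (mem_frameDomain (φ x)) _), smul_eq_mul]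
  refine Finset.sum_congr rfl fun a _ => ?_
  module

lemma pullbackConn_congr (hVW : ∀ᶠ y in nhds x, V y = W y) (v : TangentSpace I x) :
    pullbackConn I h φ V x v = pullbackConn I h φ W x v := by
  simp only [pullbackConn]
  refine Finset.sum_congr rfl fun a _ => ?_
  rw [mvfderiv_congr (f := fun y => frameCoeff J (φ x) a (φ y) (V y))
    (f' := fun y => frameCoeff J (φ x) a (φ y) (W y)) (hVW.mono fun y hy => by simp only [hy]),
    hVW.self_of_nhds]

lemma pullbackConn_add (hφ : MDiffAt φ x) (hV : DiffAlong I J φ V x) (hW : DiffAlong I J φ W x)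
    (v : TangentSpace I x) :
    pullbackConn I h φ (fun y => V y + W y) x v
      = pullbackConn I h φ V x v + pullbackConn I h φ W x v := by
  rw [diffAlong_iff hφ (mem_frameDomain _)] at hV hW
  simp only [pullbackConn, frameCoeff_add, mvfderiv_fun_add (hV _) (hW _), add_apply,
    ← Finset.sum_add_distrib]
  refine Finset.sum_congr rfl fun a _ => ?_
  module

/-- The Leibniz rule. -/
lemma pullbackConn_smul {f : M → ℝ} (hφ : MDiffAt φ x) (hf : MDiffAt f x)
    (hV : DiffAlong I J φ V x) (v : TangentSpace I x) :
    pullbackConn I h φ (fun y => f y • V y) x v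
      = mvfderiv I f x v • V x + f x • pullbackConn I h φ V x v := by
  rw [diffAlong_iff hφ (mem_frameDomain _)] at hV
  conv_rhs => rw [← sum_frameCoeff_smul_frame (mem_frameDomain (φ x)) (V x)]
  simp only [pullbackConn, frameCoeff_smul, mvfderiv_fun_mul hf (hV _), add_apply,
    Finset.smul_sum, ← Finset.sum_add_distrib, smul_apply, smul_eq_mul]
  refine Finset.sum_congr rfl fun a _ => ?_
  module

lemma diffAlong_zero (hφ : MDiffAt φ x) : DiffAlong I J φ (fun _ => 0) x := by
  rw [diffAlong_iff hφ (mem_frameDomain _)]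
  intro a
  have h0 : ∀ y, frameCoeff J (φ x) a (φ y) 0 = 0 := fun y => map_zero
    ((trivializationAt E' (TangentSpace J : N → Type _) (φ x)).localFrameCoeff J
          (Module.finBasis ℝ E') a (φ y))
  simp only [h0]
  exact mdifferentiableAt_const

lemma DiffAlong.sum {ι : Type*} (s : Finset ι) {V : ι → Π x : M, TangentSpace J (φ x)}
    (hφ : MDiffAt φ x) (hV : ∀ i ∈ s, DiffAlong I J φ (V i) x) :
    DiffAlong I J φ (fun y => ∑ i ∈ s, V i y) x := by
  classical
  induction s using Finset.induction_on with
  | empty => simpa using diffAlong_zero hφ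
  | insert i s hi ih =>
    simp only [Finset.sum_insert hi]
    exact (hV i (Finset.mem_insert_self i s)).add hφ
      (ih fun j hj => hV j (Finset.mem_insert_of_mem hj))

lemma pullbackConn_zero (hφ : MDiffAt φ x) (v : TangentSpace I x) :
    pullbackConn I h φ (fun _ => 0) x v = 0 := by
  have h1 := pullbackConn_smul h (f := fun _ => (0 : ℝ)) hφ mdifferentiableAt_const
    (diffAlong_zero hφ) v
  simpa [mvfderiv_const] using h1

lemma pullbackConn_sum {ι : Type*} (s : Finset ι) {V : ι → Π x : M, TangentSpace J (φ x)}
    (hφ : MDiffAt φ x) (hV : ∀ i ∈ s, DiffAlong I J φ (V i) x) (v : TangentSpace I x) :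
    pullbackConn I h φ (fun y => ∑ i ∈ s, V i y) x v = ∑ i ∈ s, pullbackConn I h φ (V i) x v := by
  classical
  induction s using Finset.induction_on with
  | empty => simpa using pullbackConn_zero h hφ v
  | insert i s hi ih =>
    simp only [Finset.sum_insert hi]
    rw [pullbackConn_add h hφ (hV i (Finset.mem_insert_self i s))
      (DiffAlong.sum s hφ fun j hj => hV j (Finset.mem_insert_of_mem hj)),
      ih fun j hj => hV j (Finset.mem_insert_of_mem hj)]

lemma diffAlong_comp {Y : Π z : N, TangentSpace J z} (hφ : MDiffAt φ x)
    (hY : MDiffAt (T% Y) (φ x)) : DiffAlong I J φ (fun y => Y (φ y)) x :=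
  MDifferentiableAt.comp (g := fun z => (⟨z, Y z⟩ : TangentBundle J N)) x hY hφ

/-- The pull-back connection on restrictions of vector fields. -/
lemma pullbackConn_comp {Y : Π z : N, TangentSpace J z} (hφ : MDiffAt φ x)
    (hY : MDiffAt (T% Y) (φ x)) (v : TangentSpace I x) :
    pullbackConn I h φ (fun y => Y (φ y)) x v = leviCivita h Y (φ x) (mfderiv I J φ x v) := by
  have hc : ∀ a, MDiffAt (fun z => frameCoeff J (φ x) a z (Y z)) (φ x) := fun a =>
    (diffAlong_iff (φ := id) mdifferentiableAt_id (mem_frameDomain _)).1 hY a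
  have h1 : ∀ᶠ z in nhds (φ x), Y z =
      ∑ a, frameCoeff J (φ x) a z (Y z) • frame J (φ x) a z := by
    filter_upwards [(isOpen_frameDomain (I := J) (φ x)).mem_nhds (mem_frameDomain _)] with z hz
    exact (sum_frameCoeff_smul_frame hz _).symm
  rw [leviCivita_congr h h1, leviCivita_sum h]
  · simp only [pullbackConn]
    refine Finset.sum_congr rfl fun a _ => ?_
    rw [leviCivita_smul h (hc a) (mdifferentiableAt_frame (mem_frameDomain _) a)]
    congr 2
    exact mvfderiv_comp_apply x (hc a) hφ v
  · exact fun a _ => (hc a).smul_section (mdifferentiableAt_frame (mem_frameDomain _) a)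

/-- The defining formula of the pull-back connection holds in every coordinate frame. -/
lemma pullbackConn_eq_frame (hφ : MDiffAt φ x) (hV : DiffAlong I J φ V x) {p : N}
    (hp : φ x ∈ frameDomain J p) (v : TangentSpace I x) :
    pullbackConn I h φ V x v =
      ∑ a, (mvfderiv I (fun y => frameCoeff J p a (φ y) (V y)) x v • frame J p a (φ x)
        + frameCoeff J p a (φ x) (V x) • leviCivita h (frame J p a) (φ x) (mfderiv I J φ x v)) := by
  have hc := (diffAlong_iff hφ hp).1 hV
  have h1 : ∀ᶠ y in nhds x, V y = ∑ a, frameCoeff J p a (φ y) (V y) • frame J p a (φ y) := by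
    filter_upwards [eventually_mem_frameDomain hφ.continuousAt hp] with y hy
    exact (sum_frameCoeff_smul_frame hy _).symm
  have hd : ∀ a, DiffAlong I J φ (fun y => frame J p a (φ y)) x := fun a =>
    diffAlong_comp hφ (mdifferentiableAt_frame hp a)
  rw [pullbackConn_congr h h1, pullbackConn_sum h _ hφ fun a _ => (hd a).smul hφ (hc a)]
  refine Finset.sum_congr rfl fun a _ => ?_
  rw [pullbackConn_smul h hφ (hc a) (hd a), pullbackConn_comp h hφ (mdifferentiableAt_frame hp a)]

lemma pullbackConn_sum_dir {ι : Type*} (s : Finset ι) (v : ι → TangentSpace I x) :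
    pullbackConn I h φ V x (∑ i ∈ s, v i) = ∑ i ∈ s, pullbackConn I h φ V x (v i) := by
  classical
  induction s using Finset.induction_on with
  | empty => simpa using pullbackConn_smul_dir h (V := V) (0 : ℝ) (0 : TangentSpace I x)
  | insert i s hi ih =>
    rw [Finset.sum_insert hi, Finset.sum_insert hi, pullbackConn_add_dir, ih]

lemma leviCivita_sum_dir {Y : Π z : N, TangentSpace J z} {z : N} (hY : MDiffAt (T% Y) z)
    {ι : Type*} (s : Finset ι) (c : ι → ℝ) (v : ι → TangentSpace J z) :
    leviCivita h Y z (∑ i ∈ s, c i • v i) = ∑ i ∈ s, c i • leviCivita h Y z (v i) := by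
  classical
  induction s using Finset.induction_on with
  | empty => simpa using leviCivita_smul_dir h hY (0 : ℝ) (0 : TangentSpace J z)
  | insert i s hi ih =>
    rw [Finset.sum_insert hi, Finset.sum_insert hi, leviCivita_add_dir h hY,
      leviCivita_smul_dir h hY, ih]

lemma smoothAlong_pullbackConn {X : Π x : M, TangentSpace I x} (hφ : ContMDiff I J ∞ φ)
    (hV : SmoothAlong I J φ V x) (hX : CMDiffAt ∞ (T% X) x) :
    SmoothAlong I J φ (fun y => pullbackConn I h φ V y (X y)) x := by
  have hφx : CMDiffAt ∞ φ x := hφ x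
  have hp := mem_frameDomain (I := J) (φ x)
  have hc := (smoothAlong_iff hφx hp).1 hV
  have hd := (smoothAlong_iff hφx hp).1 (smoothAlong_mfderiv (J := J) hφx hX)
  have key : SmoothAlong I J φ (fun y => ∑ a,
      (mvfderiv I (fun y => frameCoeff J (φ x) a (φ y) (V y)) y (X y) • frame J (φ x) a (φ y)
        + frameCoeff J (φ x) a (φ y) (V y) •
          ∑ b, frameCoeff J (φ x) b (φ y) (mfderiv I J φ y (X y)) •
            leviCivita h (frame J (φ x) a) (φ y) (frame J (φ x) b (φ y)))) x := by
    refine SmoothAlong.sum hφx fun a _ => SmoothAlong.add hφx ?_ ?_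
    · exact (smoothAlong_comp hφx (contMDiffAt_frame hp a)).smul hφx
        (contMDiffAt_mvfderiv (hc a) hX)
    · refine SmoothAlong.smul hφx (hc a) (SmoothAlong.sum hφx fun b _ =>
        SmoothAlong.smul hφx (hd b) ?_)
      exact smoothAlong_comp (Y := fun z => leviCivita h (frame J (φ x) a) z (frame J (φ x) b z))
        hφx (contMDiffAt_leviCivita h (contMDiffAt_frame hp b) (contMDiffAt_frame hp a))
  refine key.congr ?_
  filter_upwards [eventually_mem_frameDomain hφx.continuousAt hp, hV.eventually_diffAlong]
    with y hy hVy
  rw [pullbackConn_eq_frame h (hφ.mdifferentiable (by simp) y) hVy hy]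
  refine Finset.sum_congr rfl fun a _ => ?_
  rw [← leviCivita_sum_dir h (mdifferentiableAt_frame hy a), sum_frameCoeff_smul_frame hy]

end Pullback

section Tension

variable {E : Type*} [NormedAddCommGroup E] [NormedSpace ℝ E] [FiniteDimensional ℝ E]
  {H : Type*} [TopologicalSpace H] {I : ModelWithCorners ℝ E H}
  {M : Type*} [TopologicalSpace M] [ChartedSpace H M] [IsManifold I ∞ M]
  {E' : Type*} [NormedAddCommGroup E'] [NormedSpace ℝ E'] [FiniteDimensional ℝ E']
  {H' : Type*} [TopologicalSpace H'] {J : ModelWithCorners ℝ E' H'}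
  {N : Type*} [TopologicalSpace N] [ChartedSpace H' N] [IsManifold J ∞ N]
  (g : Metric I M) (h : Metric J N) {φ : M → N}

lemma SmoothAlong.sub {V W : Π x : M, TangentSpace J (φ x)} {x : M}
    (hφ : CMDiffAt ∞ φ x) (hV : SmoothAlong I J φ V x) (hW : SmoothAlong I J φ W x) :
    SmoothAlong I J φ (fun y => V y - W y) x := by
  have h1 := hV.add hφ (hW.smul (f := fun _ => (-1 : ℝ)) hφ contMDiffAt_const)
  refine h1.congr (Filter.Eventually.of_forall fun y => ?_)
  module

lemma tensorialAt_hessian (hφ : ContMDiff I J ∞ φ) (x : M) (v : TangentSpace I x) :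
    TensorialAt I E (fun Y => pullbackConn I h φ (fun y => mfderiv I J φ y (Y y)) x v
      - mfderiv I J φ x (leviCivita g Y x v)) x where
  smul {f Y} hf hY := by
    have hφx : MDiffAt φ x := hφ.mdifferentiable (by simp) x
    have e1 := pullbackConn_smul h hφx hf (diffAlong_mfderiv hφ hY) v
    have e2 := leviCivita_smul g hf hY v
    have e3 : (fun y => mfderiv I J φ y ((f • Y) y)) = fun y => f y • mfderiv I J φ y (Y y) :=
      funext fun y => map_smul _ _ _
    rw [e3, e1]
    change _ - mfderiv I J φ x (leviCivita g (fun y => f y • Y y) x v) = _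
    rw [e2, map_add, map_smul, map_smul]
    module
  add {Y Y'} hY hY' := by
    have hφx : MDiffAt φ x := hφ.mdifferentiable (by simp) x
    have e1 := pullbackConn_add h hφx (diffAlong_mfderiv hφ hY) (diffAlong_mfderiv hφ hY') v
    have e2 := leviCivita_add g hY hY' v
    have e3 : (fun y => mfderiv I J φ y ((Y + Y') y)) =
        fun y => mfderiv I J φ y (Y y) + mfderiv I J φ y (Y' y) :=
      funext fun y => map_add _ _ _
    rw [e3, e1]
    change _ - mfderiv I J φ x (leviCivita g (fun y => Y y + Y' y) x v) = _
    rw [e2, map_add]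
    abel

/-- The second fundamental form `∇ dφ` at a point, as a bilinear map. -/
def hessianMap (hφ : ContMDiff I J ∞ φ) (x : M) :
    TangentSpace I x →ₗ[ℝ] TangentSpace I x →ₗ[ℝ] TangentSpace J (φ x) :=
  LinearMap.mk₂ ℝ (fun v w => TensorialAt.mkHom _ x (tensorialAt_hessian g h hφ x v) w)
    (fun v v' w => by
      simp only [TensorialAt.mkHom_apply_eq_extend, pullbackConn_add_dir,
        map_add, leviCivita_add_dir g (FiberBundle.mdifferentiableAt_extend I E w)]
      abel)
    (fun c v w => by
      simp only [TensorialAt.mkHom_apply_eq_extend, pullbackConn_smul_dir,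
        leviCivita_smul_dir g (FiberBundle.mdifferentiableAt_extend I E w), map_smul, smul_sub])
    (fun v w w' => map_add _ _ _) (fun c v w => map_smul _ _ _)

lemma hessianMap_apply (hφ : ContMDiff I J ∞ φ) (x : M) (v : TangentSpace I x)
    {Y : Π x : M, TangentSpace I x} (hY : MDiffAt (T% Y) x) :
    hessianMap g h hφ x v (Y x) = pullbackConn I h φ (fun y => mfderiv I J φ y (Y y)) x v
      - mfderiv I J φ x (leviCivita g Y x v) :=
  TensorialAt.mkHom_apply (tensorialAt_hessian g h hφ x v) hY

/-- The tension field can be computed in any coordinate frame. -/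
lemma tension_eq_frame (hφ : ContMDiff I J ∞ φ) {p x : M} (hx : x ∈ frameDomain I p) :
    tension g h φ x = bilinTrace (g.inner x) (fun i => frame I p i x) fun i j =>
      pullbackConn I h φ (fun y => mfderiv I J φ y (frame I p j y)) x (frame I p i x)
        - mfderiv I J φ x (leviCivita g (frame I p j) x (frame I p i x)) := by
  have h1 : ∀ (q : M) (hq : x ∈ frameDomain I q) i j,
      pullbackConn I h φ (fun y => mfderiv I J φ y (frame I q j y)) x (frame I q i x)
        - mfderiv I J φ x (leviCivita g (frame I q j) x (frame I q i x)) =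
      hessianMap g h hφ x (frame I q i x) (frame I q j x) := fun q hq i j =>
    (hessianMap_apply g h hφ x _ (mdifferentiableAt_frame hq j)).symm
  have h2 := bilinTrace_basis_eq (g.symm x) (g.pos x) (frameBasis hx)
    (frameBasis (mem_frameDomain (I := I) x)) (hessianMap g h hφ x)
  simp only [frameBasis_coe] at h2
  simp only [h1 p hx]
  rw [← h2]
  simp only [← h1 x (mem_frameDomain x)]
  rfl

/-- The tension field of a smooth map is smooth. -/
lemma smoothAlong_tension (hφ : ContMDiff I J ∞ φ) (x : M) :
    SmoothAlong I J φ (tension g h φ) x := by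
  have hx := mem_frameDomain (I := I) x
  have key : SmoothAlong I J φ (fun y => bilinTrace (g.inner y) (fun i => frame I x i y)
      fun i j => pullbackConn I h φ (fun y => mfderiv I J φ y (frame I x j y)) y (frame I x i y)
        - mfderiv I J φ y (leviCivita g (frame I x j) y (frame I x i y))) x := by
    refine SmoothAlong.sum (hφ x) fun i _ => SmoothAlong.sum (hφ x) fun j _ =>
      SmoothAlong.smul (hφ x) (contMDiffAt_gram_inv g hx i j) (SmoothAlong.sub (hφ x) ?_ ?_)
    · exact smoothAlong_pullbackConn h hφ (smoothAlong_mfderiv (hφ x) (contMDiffAt_frame hx j))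
        (contMDiffAt_frame hx i)
    · exact smoothAlong_mfderiv (hφ x)
        (contMDiffAt_leviCivita g (contMDiffAt_frame hx i) (contMDiffAt_frame hx j))
  refine key.congr ?_
  filter_upwards [(isOpen_frameDomain (I := I) x).mem_nhds hx] with y hy
  exact tension_eq_frame g h hφ hy

end Tension

section Laplacian

variable {E : Type*} [NormedAddCommGroup E] [NormedSpace ℝ E] [FiniteDimensional ℝ E]
  {H : Type*} [TopologicalSpace H] {I : ModelWithCorners ℝ E H}
  {M : Type*} [TopologicalSpace M] [ChartedSpace H M] [IsManifold I ∞ M]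
  {E' : Type*} [NormedAddCommGroup E'] [NormedSpace ℝ E'] [FiniteDimensional ℝ E']
  {H' : Type*} [TopologicalSpace H'] {J : ModelWithCorners ℝ E' H'}
  {N : Type*} [TopologicalSpace N] [ChartedSpace H' N] [IsManifold J ∞ N]
  (g : Metric I M) (h : Metric J N) {φ : M → N}

lemma pullbackConn_grad (f : M → ℝ) (V : Π x : M, TangentSpace J (φ x)) (x : M) :
    pullbackConn I h φ V x (grad g f x) = trace g x fun i j =>
      mvfderiv I f x (frame I x i x) • pullbackConn I h φ V x (frame I x j x) := by
  simp only [grad, sharp, trace, pullbackConn_sum_dir, pullbackConn_smul_dir, smul_smul]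

lemma trace_swap (x : M) {W : Type*} [AddCommGroup W] [Module ℝ W]
    (B : Fin (Module.finrank ℝ E) → Fin (Module.finrank ℝ E) → W) :
    trace g x (fun i j => B j i) = trace g x B := by
  rw [trace, trace, Finset.sum_comm]
  exact Finset.sum_congr rfl fun i _ => Finset.sum_congr rfl fun j _ => by rw [invGram_symm]

lemma trace_add (x : M) {W : Type*} [AddCommGroup W] [Module ℝ W]
    (B C : Fin (Module.finrank ℝ E) → Fin (Module.finrank ℝ E) → W) :
    trace g x (fun i j => B i j + C i j) = trace g x B + trace g x C := by
  simp only [trace, smul_add, Finset.sum_add_distrib]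

lemma trace_sub (x : M) {W : Type*} [AddCommGroup W] [Module ℝ W]
    (B C : Fin (Module.finrank ℝ E) → Fin (Module.finrank ℝ E) → W) :
    trace g x (fun i j => B i j - C i j) = trace g x B - trace g x C := by
  simp only [trace, smul_sub, Finset.sum_sub_distrib]

lemma trace_map (x : M) {W W' : Type*} [AddCommGroup W] [Module ℝ W] [AddCommGroup W']
    [Module ℝ W'] (L : W →ₗ[ℝ] W')
    (B : Fin (Module.finrank ℝ E) → Fin (Module.finrank ℝ E) → W) :
    trace g x (fun i j => L (B i j)) = L (trace g x B) := by
  simp only [trace, map_sum, map_smul]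

lemma trace_smul (x : M) {W : Type*} [AddCommGroup W] [Module ℝ W] (c : ℝ)
    (B : Fin (Module.finrank ℝ E) → Fin (Module.finrank ℝ E) → W) :
    trace g x (fun i j => c • B i j) = c • trace g x B :=
  trace_map g x (LinearMap.lsmul ℝ W c) B

lemma trace_smul_const (x : M) {W : Type*} [AddCommGroup W] [Module ℝ W] (w : W)
    (B : Fin (Module.finrank ℝ E) → Fin (Module.finrank ℝ E) → ℝ) :
    trace g x (fun i j => B i j • w) = trace g x B • w :=
  trace_map g x (LinearMap.toSpanSingleton ℝ W w) B

/-- The Leibniz rule for the rough Laplacian. -/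
lemma roughLaplacian_smul {f : M → ℝ} {V : Π x : M, TangentSpace J (φ x)} {x : M}
    (hφ : ContMDiff I J ∞ φ) (hf : ContMDiff I 𝓘(ℝ, ℝ) ∞ f) (hV : ∀ y, SmoothAlong I J φ V y) :
    roughLaplacian g h φ (fun y => f y • V y) x = f x • roughLaplacian g h φ V x
      + (2 : ℝ) • pullbackConn I h φ V x (grad g f x) + laplacian g f x • V x := by
  have hφd : ∀ y, MDiffAt φ y := hφ.mdifferentiable (by simp)
  have hfd : ∀ y, MDiffAt f y := hf.mdifferentiable (by simp)
  have hx := mem_frameDomain (I := I) x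
  have e : ∀ i j, pullbackConn I h φ
        (fun y => pullbackConn I h φ (fun y => f y • V y) y (frame I x j y)) x (frame I x i x)
      - pullbackConn I h φ (fun y => f y • V y) x (leviCivita g (frame I x j) x (frame I x i x)) =
      f x • (pullbackConn I h φ (fun y => pullbackConn I h φ V y (frame I x j y)) x (frame I x i x)
        - pullbackConn I h φ V x (leviCivita g (frame I x j) x (frame I x i x)))
      + (mvfderiv I f x (frame I x j x) • pullbackConn I h φ V x (frame I x i x)
        + mvfderiv I f x (frame I x i x) • pullbackConn I h φ V x (frame I x j x))
      + (mvfderiv I (fun y => mvfderiv I f y (frame I x j y)) x (frame I x i x)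
        - mvfderiv I f x (leviCivita g (frame I x j) x (frame I x i x))) • V x := by
    intro i j
    have e1 : (fun y => pullbackConn I h φ (fun y => f y • V y) y (frame I x j y)) =
        fun y => mvfderiv I f y (frame I x j y) • V y
          + f y • pullbackConn I h φ V y (frame I x j y) :=
      funext fun y => pullbackConn_smul h (hφd y) (hfd y) (hV y).diffAlong _
    have s1 : MDiffAt (fun y => mvfderiv I f y (frame I x j y)) x :=
      (contMDiffAt_mvfderiv (hf x) (contMDiffAt_frame hx j)).mdifferentiableAt (by simp)
    have s2 : DiffAlong I J φ (fun y => pullbackConn I h φ V y (frame I x j y)) x :=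
      (smoothAlong_pullbackConn h hφ (hV x) (contMDiffAt_frame hx j)).diffAlong
    rw [e1, pullbackConn_add h (hφd x) ((hV x).diffAlong.smul (hφd x) s1)
      (s2.smul (hφd x) (hfd x)), pullbackConn_smul h (hφd x) s1 (hV x).diffAlong,
      pullbackConn_smul h (hφd x) (hfd x) s2,
      pullbackConn_smul h (hφd x) (hfd x) (hV x).diffAlong]
    module
  have sw := trace_swap g x fun i j =>
    mvfderiv I f x (frame I x i x) • pullbackConn I h φ V x (frame I x j x)
  unfold roughLaplacian
  simp only [e]
  rw [trace_add, trace_add, trace_add, trace_smul, trace_smul_const, pullbackConn_grad, sw,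
    two_smul]
  rfl

lemma mvfderiv_log {F : M → ℝ} {y : M} (hF : MDiffAt F y) (hpos : 0 < F y) (v : TangentSpace I y) :
    mvfderiv I F y v = F y * mvfderiv I (fun y => Real.log (F y)) y v := by
  have hl : HasDerivAt Real.log (F y)⁻¹ (F y) := Real.hasDerivAt_log hpos.ne'
  have h1 := mvfderiv_comp_apply (I := 𝓘(ℝ, ℝ)) (g := Real.log) y
    hl.differentiableAt.mdifferentiableAt hF v
  change mvfderiv I (fun y => Real.log (F y)) y v = _ at h1
  have h2 : ∀ w : ℝ, mvfderiv 𝓘(ℝ, ℝ) Real.log (F y) w = (F y)⁻¹ * w := by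
    intro w
    simp only [mvfderiv, mfderiv_eq_fderiv, hl.hasFDerivAt.fderiv]
    change ContinuousLinearMap.toSpanSingleton ℝ (F y)⁻¹ w = _
    simp [mul_comm]
  have h3 : mvfderiv I (fun y => Real.log (F y)) y v = (F y)⁻¹ * mvfderiv I F y v :=
    h1.trans (h2 _)
  rw [h3, mul_inv_cancel_left₀ hpos.ne']

lemma contMDiff_log {F : M → ℝ} (hF : ContMDiff I 𝓘(ℝ, ℝ) ∞ F) (hpos : ∀ y, 0 < F y) :
    ContMDiff I 𝓘(ℝ, ℝ) ∞ (fun y => Real.log (F y)) := fun y =>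
  ContMDiffAt.comp (g := Real.log) y
    (contMDiffAt_iff_contDiffAt.2 (Real.contDiffAt_log.2 (hpos y).ne')) (hF y)

lemma mvfderiv_sq {F : M → ℝ} {y : M} (hF : MDiffAt F y) (hpos : 0 < F y) (v : TangentSpace I y) :
    mvfderiv I (fun y => F y ^ 2) y v =
      2 * F y ^ 2 * mvfderiv I (fun y => Real.log (F y)) y v := by
  have h1 : (fun y => F y ^ 2) = fun y => F y * F y := funext fun y => sq _
  rw [h1, mvfderiv_fun_mul hF hF]
  simp only [add_apply, smul_apply, smul_eq_mul, mvfderiv_log hF hpos]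
  ring

lemma grad_sq {F : M → ℝ} {x : M} (hF : MDiffAt F x) (hpos : 0 < F x) :
    grad g (fun y => F y ^ 2) x = (2 * F x ^ 2) • grad g (fun y => Real.log (F y)) x := by
  simp only [grad, sharp, mvfderiv_sq hF hpos, Finset.smul_sum, smul_smul]
  refine Finset.sum_congr rfl fun i _ => Finset.sum_congr rfl fun j _ => ?_
  congr 1
  ring

lemma inner_grad (f : M → ℝ) (x : M) (v : TangentSpace I x) :
    g.inner x (grad g f x) v = mvfderiv I f x v :=
  inner_sharp g (mvfderiv I f x : TangentSpace I x →ₗ[ℝ] ℝ) v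

lemma inner_grad_grad (f : M → ℝ) (x : M) : g.inner x (grad g f x) (grad g f x) =
    trace g x fun i j => mvfderiv I f x (frame I x i x) * mvfderiv I f x (frame I x j x) := by
  rw [inner_grad]
  conv_lhs => rw [grad, sharp]
  simp only [map_sum, map_smul, trace, smul_eq_mul, mul_assoc]

lemma laplacian_sq {F : M → ℝ} {x : M} (hF : ContMDiff I 𝓘(ℝ, ℝ) ∞ F) (hpos : ∀ y, 0 < F y) :
    laplacian g (fun y => F y ^ 2) x = 2 * F x ^ 2 * (laplacian g (fun y => Real.log (F y)) x
      + 2 * g.inner x (grad g (fun y => Real.log (F y)) x)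
        (grad g (fun y => Real.log (F y)) x)) := by
  have hFd : ∀ y, MDiffAt F y := hF.mdifferentiable (by simp)
  have hx := mem_frameDomain (I := I) x
  have tm : ∀ (c : ℝ) (B : Fin (Module.finrank ℝ E) → Fin (Module.finrank ℝ E) → ℝ),
    c * trace g x B = trace g x fun i j => c * B i j := fun c B => (trace_smul g x c B).symm
  rw [inner_grad_grad, laplacian, laplacian, tm, ← trace_add, tm]
  congr 1
  funext i j
  have s1 : MDiffAt (fun y => mvfderiv I (fun y => Real.log (F y)) y (frame I x j y)) x :=
    (contMDiffAt_mvfderiv (contMDiff_log hF hpos x)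
      (contMDiffAt_frame hx j)).mdifferentiableAt (by simp)
  have s2 : MDifferentiableAt I 𝓘(ℝ, ℝ) (fun y => 2 * F y ^ 2) x :=
    (contMDiffAt_const.mul ((hF x).pow 2)).mdifferentiableAt (n := ∞) (by simp)
  have s3 : MDiffAt (fun y => F y ^ 2) x := ((hF x).pow 2).mdifferentiableAt (n := ∞) (by simp)
  simp only [fun y => mvfderiv_sq (hFd y) (hpos y)]
  rw [mvfderiv_fun_mul s2 s1, mvfderiv_fun_mul mdifferentiableAt_const s3, mvfderiv_const]
  simp only [add_apply, smul_apply, smul_eq_mul, mvfderiv_sq (hFd x) (hpos x), zero_apply]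
  ring

end Laplacian

section Conformal

variable {E : Type*} [NormedAddCommGroup E] [NormedSpace ℝ E] [FiniteDimensional ℝ E]
  {H : Type*} [TopologicalSpace H] {I : ModelWithCorners ℝ E H}
  {M : Type*} [TopologicalSpace M] [ChartedSpace H M] [IsManifold I ∞ M]
  {E' : Type*} [NormedAddCommGroup E'] [NormedSpace ℝ E'] [FiniteDimensional ℝ E']
  {H' : Type*} [TopologicalSpace H'] {J : ModelWithCorners ℝ E' H'}
  {N : Type*} [TopologicalSpace N] [ChartedSpace H' N] [IsManifold J ∞ N]
  {g gbar : Metric I M} {lam : M → ℝ}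

lemma invGram_conformal {x : M} (hlam : lam x ≠ 0)
    (hg : ∀ (x : M) (u v : TangentSpace I x), gbar.inner x u v = lam x * g.inner x u v) :
    invGram gbar x = (lam x)⁻¹ • invGram g x := by
  have h1 : gram (gbar.inner x) (fun i => frame I x i x) =
      (Units.mk0 (lam x) hlam) • gram (g.inner x) (fun i => frame I x i x) := by
    ext i j
    simp [gram, hg, Units.smul_def]
  have h2 : IsUnit (gram (g.inner x) (fun i => frame I x i x)).det := by
    rw [← frameBasis_coe (mem_frameDomain (I := I) x)]
    exact isUnit_det_gram (g.pos x) _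
  rw [invGram_eq, invGram_eq, h1, Matrix.inv_smul' _ _ h2]
  simp [Units.smul_def]

lemma trace_conformal {x : M} (hlam : lam x ≠ 0)
    (hg : ∀ (x : M) (u v : TangentSpace I x), gbar.inner x u v = lam x * g.inner x u v)
    {W : Type*} [AddCommGroup W] [Module ℝ W]
    (B : Fin (Module.finrank ℝ E) → Fin (Module.finrank ℝ E) → W) :
    trace gbar x B = (lam x)⁻¹ • trace g x B := by
  simp only [trace, invGram_conformal hlam hg, Matrix.smul_apply, smul_eq_mul, Finset.smul_sum,
    smul_smul]

/-- The change of the Koszul expression under a conformal change of the metric. -/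
lemma koszul_conformal {x : M} (hl : MDiffAt lam x)
    (hg : ∀ (x : M) (u v : TangentSpace I x), gbar.inner x u v = lam x * g.inner x u v)
    {X Y Z : Π x : M, TangentSpace I x} (hX : MDiffAt (T% X) x) (hY : MDiffAt (T% Y) x)
    (hZ : MDiffAt (T% Z) x) :
    koszul gbar X Y Z x = lam x * koszul g X Y Z x + (mvfderiv I lam x (X x) * g.inner x (Y x) (Z x)
      + mvfderiv I lam x (Y x) * g.inner x (X x) (Z x)
      - mvfderiv I lam x (Z x) * g.inner x (X x) (Y x)) := by
  simp only [koszul, hg, mvfderiv_fun_mul hl (mdifferentiableAt_inner g hY hZ),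
    mvfderiv_fun_mul hl (mdifferentiableAt_inner g hX hZ),
    mvfderiv_fun_mul hl (mdifferentiableAt_inner g hX hY), add_apply, smul_apply, smul_eq_mul]
  ring

/-- In dimension two, the trace of `∇` in a coordinate frame is conformally invariant. -/
lemma trace_leviCivita_conformal (hdim : Module.finrank ℝ E = 2) {x : M} (hl : MDiffAt lam x)
    (hlam : lam x ≠ 0)
    (hg : ∀ (x : M) (u v : TangentSpace I x), gbar.inner x u v = lam x * g.inner x u v) :
    trace g x (fun i j => leviCivita gbar (frame I x j) x (frame I x i x)) =
      trace g x (fun i j => leviCivita g (frame I x j) x (frame I x i x)) := by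
  have hx := mem_frameDomain (I := I) x
  refine ext_inner g fun z => ?_
  have hz := mdifferentiableAt_extendVec z
  have tm : ∀ (B : Fin (Module.finrank ℝ E) → Fin (Module.finrank ℝ E) → TangentSpace I x),
      g.inner x (trace g x B) z = trace g x fun i j => g.inner x (B i j) z := fun B => by
    simp only [trace, map_sum, map_smul, sum_apply, smul_apply]
  rw [tm, tm]
  have e : ∀ i j, g.inner x (leviCivita gbar (frame I x j) x (frame I x i x)) z =
      g.inner x (leviCivita g (frame I x j) x (frame I x i x)) z + ((lam x)⁻¹ / 2) *
        (mvfderiv I lam x (frame I x i x) * g.inner x (frame I x j x) z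
        + mvfderiv I lam x (frame I x j x) * g.inner x (frame I x i x) z
        - mvfderiv I lam x z * g.inner x (frame I x i x) (frame I x j x)) := by
    intro i j
    have e1 := inner_leviCivita gbar (mdifferentiableAt_frame hx i) (mdifferentiableAt_frame hx j) hz
    have e2 := inner_leviCivita g (mdifferentiableAt_frame hx i) (mdifferentiableAt_frame hx j) hz
    rw [koszul_conformal hl hg (mdifferentiableAt_frame hx i) (mdifferentiableAt_frame hx j) hz,
      hg] at e1
    rw [extendVec_self] at e1 e2
    rw [← mul_right_inj' hlam, e1, e2]
    field_simp
  simp only [e]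
  have tr0 : trace g x (fun i j => mvfderiv I lam x (frame I x i x) * g.inner x (frame I x j x) z
        + mvfderiv I lam x (frame I x j x) * g.inner x (frame I x i x) z
        - mvfderiv I lam x z * g.inner x (frame I x i x) (frame I x j x)) = 0 := by
    have t1 : trace g x (fun i j => mvfderiv I lam x (frame I x i x) * g.inner x (frame I x j x) z)
        = mvfderiv I lam x z := by
      rw [← inner_grad g lam x z, grad, sharp]
      simp only [map_sum, map_smul, sum_apply, smul_apply, trace, smul_eq_mul, mul_assoc]
    have t2 : trace g x (fun i j => g.inner x (frame I x i x) (frame I x j x)) = 2 := by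
      have hu : IsUnit (gram (g.inner x) (fun i => frame I x i x)).det := by
        rw [← frameBasis_coe hx]
        exact isUnit_det_gram (g.pos x) _
      have h3 := congrArg Matrix.trace (Matrix.nonsing_inv_mul _ hu)
      rw [Matrix.trace_one, Fintype.card_fin] at h3
      have h4 : ((Module.finrank ℝ E : ℕ) : ℝ) = 2 := by exact_mod_cast hdim
      refine Eq.trans ?_ (h3.trans h4)
      simp only [trace, Matrix.trace, Matrix.diag, Matrix.mul_apply, smul_eq_mul, invGram_eq]
      refine Finset.sum_congr rfl fun i _ => Finset.sum_congr rfl fun j _ => ?_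
      rw [g.symm x]
      rfl
    have t3 := trace_swap g x fun i j =>
      mvfderiv I lam x (frame I x i x) * g.inner x (frame I x j x) z
    have t4 := trace_smul g x (mvfderiv I lam x z)
      fun i j => g.inner x (frame I x i x) (frame I x j x)
    simp only [smul_eq_mul] at t4
    rw [trace_sub, trace_add, t3, t1, t4, t2]
    ring
  have t5 := trace_smul g x ((lam x)⁻¹ / 2) fun i j =>
    mvfderiv I lam x (frame I x i x) * g.inner x (frame I x j x) z
        + mvfderiv I lam x (frame I x j x) * g.inner x (frame I x i x) z
        - mvfderiv I lam x z * g.inner x (frame I x i x) (frame I x j x)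
  simp only [smul_eq_mul] at t5
  rw [trace_add, t5, tr0, mul_zero, add_zero]

variable (h : Metric J N) {φ : M → N}

lemma tension_conformal (hdim : Module.finrank ℝ E = 2) {x : M} (hl : MDiffAt lam x)
    (hlam : lam x ≠ 0)
    (hg : ∀ (x : M) (u v : TangentSpace I x), gbar.inner x u v = lam x * g.inner x u v) :
    tension gbar h φ x = (lam x)⁻¹ • tension g h φ x := by
  unfold tension
  rw [trace_conformal hlam hg, trace_sub, trace_sub]
  have e := trace_leviCivita_conformal hdim hl hlam hg
  have e1 := trace_map g x (mfderiv I J φ x : TangentSpace I x →ₗ[ℝ] TangentSpace J (φ x))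
    fun i j => leviCivita gbar (frame I x j) x (frame I x i x)
  have e2 := trace_map g x (mfderiv I J φ x : TangentSpace I x →ₗ[ℝ] TangentSpace J (φ x))
    fun i j => leviCivita g (frame I x j) x (frame I x i x)
  simp only [ContinuousLinearMap.coe_coe] at e1 e2
  rw [e1, e2, e]

/-- `pullbackConn I h φ V x` as a linear map. -/
def pullbackConnLinear (h : Metric J N) (φ : M → N) (V : Π x : M, TangentSpace J (φ x)) (x : M) :
    TangentSpace I x →ₗ[ℝ] TangentSpace J (φ x) where
  toFun := pullbackConn I h φ V x
  map_add' := pullbackConn_add_dir h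
  map_smul' := pullbackConn_smul_dir h

lemma roughLaplacian_conformal (hdim : Module.finrank ℝ E = 2) {x : M} (hl : MDiffAt lam x)
    (hlam : lam x ≠ 0)
    (hg : ∀ (x : M) (u v : TangentSpace I x), gbar.inner x u v = lam x * g.inner x u v)
    (V : Π x : M, TangentSpace J (φ x)) :
    roughLaplacian gbar h φ V x = (lam x)⁻¹ • roughLaplacian g h φ V x := by
  unfold roughLaplacian
  rw [trace_conformal hlam hg, trace_sub, trace_sub]
  have e := trace_leviCivita_conformal hdim hl hlam hg
  have e1 := trace_map g x (pullbackConnLinear (I := I) h φ V x)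
    fun i j => leviCivita gbar (frame I x j) x (frame I x i x)
  have e2 := trace_map g x (pullbackConnLinear (I := I) h φ V x)
    fun i j => leviCivita g (frame I x j) x (frame I x i x)
  rw [e, ← e2] at e1
  exact congrArg (fun w => (lam x)⁻¹ • (_ - w)) e1

lemma extendVec_eventually_mdifferentiableAt {z : N} (v : TangentSpace J z) :
    ∀ᶠ y in nhds z, MDiffAt (T% (extendVec J v)) y :=
  eventually_mdifferentiableAt_section (contMDiffAt_extendVec v)

lemma leviCivita_const_smul {z : N} (c : ℝ) {Y : Π z : N, TangentSpace J z}
    (hY : MDiffAt (T% Y) z) (v : TangentSpace J z) :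
    leviCivita h (fun y => c • Y y) z v = c • leviCivita h Y z v := by
  rw [leviCivita_smul h (f := fun _ => c) mdifferentiableAt_const hY]
  simp [mvfderiv_const]

lemma curvature_smul (z : N) (u v w : TangentSpace J z) (c : ℝ) :
    curvature h z u (c • v) w = c • curvature h z u v w := by
  have : CompleteSpace E' := FiniteDimensional.complete ℝ E'
  have hw := mdifferentiableAt_extendVec w
  have hv := mdifferentiableAt_extendVec v
  have e1 : ∀ᶠ y in nhds z, leviCivita h (extendVec J w) y (extendVec J (c • v) y) =
      c • leviCivita h (extendVec J w) y (extendVec J v y) := by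
    filter_upwards [extendVec_smul c v, extendVec_eventually_mdifferentiableAt w] with y hy hwy
    rw [hy, leviCivita_smul_dir h hwy]
  have s1 : MDiffAt (T% (fun y => leviCivita h (extendVec J w) y (extendVec J v y))) z :=
    (contMDiffAt_leviCivita h (contMDiffAt_extendVec v)
      (contMDiffAt_extendVec w)).mdifferentiableAt (by simp)
  have s2 : MDiffAt (T% (fun y => leviCivita h (extendVec J w) y (extendVec J u y))) z :=
    (contMDiffAt_leviCivita h (contMDiffAt_extendVec u)
      (contMDiffAt_extendVec w)).mdifferentiableAt (by simp)
  have e2 : mlieBracket J (extendVec J u) (extendVec J (c • v)) z =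
      c • mlieBracket J (extendVec J u) (extendVec J v) z := by
    rw [← mlieBracket_const_smul_right hv]
    exact Filter.EventuallyEq.mlieBracket_vectorField_eq (Filter.EventuallyEq.refl _ _)
      (extendVec_smul c v)
  unfold curvature
  rw [leviCivita_congr h e1, leviCivita_const_smul h c s1, e2, leviCivita_smul_dir h hw,
    leviCivita_smul_dir h s2]
  module

end Conformal
end Biharmonic
end

theorem mainTheorem7
    {E : Type*} [NormedAddCommGroup E] [NormedSpace ℝ E] [FiniteDimensional ℝ E]
    {H : Type*} [TopologicalSpace H] {I : ModelWithCorners ℝ E H} [I.Boundaryless]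
    {M : Type*} [TopologicalSpace M] [ChartedSpace H M] [IsManifold I ∞ M]
    {E' : Type*} [NormedAddCommGroup E'] [NormedSpace ℝ E'] [FiniteDimensional ℝ E']
    {H' : Type*} [TopologicalSpace H'] {J : ModelWithCorners ℝ E' H'} [J.Boundaryless]
    {N : Type*} [TopologicalSpace N] [ChartedSpace H' N] [IsManifold J ∞ N]
    (hdim : Module.finrank ℝ E = 2)
    (g gbar : Biharmonic.Metric I M) (h : Biharmonic.Metric J N)
    (φ : M → N) (hφ : ContMDiff I J ∞ φ)
    (F : M → ℝ) (hF : ContMDiff I 𝓘(ℝ, ℝ) ∞ F) (hFpos : ∀ x, 0 < F x)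
    (hgbar : ∀ (x : M) (u v : TangentSpace I x),
      gbar.inner x u v = (F x) ^ (-2 : ℤ) * g.inner x u v)
    (x : M) :
    Biharmonic.bitension gbar h φ x =
      (F x) ^ 4 •
        (Biharmonic.bitension g h φ x
          + (2 * (Biharmonic.laplacian g (fun y => Real.log (F y)) x
              + 2 * g.inner x (Biharmonic.grad g (fun y => Real.log (F y)) x)
                  (Biharmonic.grad g (fun y => Real.log (F y)) x))) •
              Biharmonic.tension g h φ x
          + (4 : ℝ) • Biharmonic.pullbackConn I h φ (Biharmonic.tension g h φ) x
              (Biharmonic.grad g (fun y => Real.log (F y)) x)) := by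

  have hlam : ∀ y, (F y) ^ (-2 : ℤ) ≠ 0 := fun y => zpow_ne_zero _ (hFpos y).ne'
  have hinv : ∀ y, ((F y) ^ (-2 : ℤ))⁻¹ = F y ^ 2 := fun y => by
    rw [← zpow_neg, neg_neg]
    exact zpow_ofNat (F y) 2
  have hF2 : ContMDiff I 𝓘(ℝ, ℝ) ∞ fun y => F y ^ 2 := hF.pow 2
  have hl : ∀ y, MDifferentiableAt I 𝓘(ℝ, ℝ) (fun y => (F y) ^ (-2 : ℤ)) y := fun y => by
    have h1 := MDifferentiableAt.comp (g := fun t : ℝ => t ^ (-2 : ℤ)) y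
      (differentiableAt_zpow.2 (Or.inl (hFpos y).ne')).mdifferentiableAt
      (hF.mdifferentiable (by simp) y)
    exact h1
  have ht : Biharmonic.tension gbar h φ = fun y => F y ^ 2 • Biharmonic.tension g h φ y :=
    funext fun y => by
      rw [Biharmonic.tension_conformal (lam := fun y => (F y) ^ (-2 : ℤ)) h hdim (hl y) (hlam y)
        hgbar, hinv]
  have hR := Biharmonic.trace_smul g x (F x ^ 2) fun i j => Biharmonic.curvature h (φ x)
    (mfderiv I J φ x (Biharmonic.frame I x i x)) (Biharmonic.tension g h φ x)
    (mfderiv I J φ x (Biharmonic.frame I x j x))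
  unfold Biharmonic.bitension Biharmonic.jacobi
  rw [ht, Biharmonic.roughLaplacian_conformal (lam := fun y => (F y) ^ (-2 : ℤ)) h hdim (hl x)
      (hlam x) hgbar,
    Biharmonic.trace_conformal (lam := fun y => (F y) ^ (-2 : ℤ)) (hlam x) hgbar, hinv,
    Biharmonic.roughLaplacian_smul g h hφ hF2 (Biharmonic.smoothAlong_tension g h hφ),
    Biharmonic.grad_sq g (hF.mdifferentiable (by simp) x) (hFpos x),
    Biharmonic.pullbackConn_smul_dir, Biharmonic.laplacian_sq g hF hFpos]
  simp only [Biharmonic.curvature_smul]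
  rw [hR]
  module
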